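/- Let $\mathbb T=\mathbb R/\mathbb Z$, let $|\cdot|$ be the supremum norm on $\mathbb R^2$ and on $\mathbb R^4$, and for $R>0$ let $B_R=[-R,R]^2\subset\mathbb R^2$. For an integer $k\ge 0$, $|g|_k$ denotes the $C^k$ norm, i.e. the supremum over the domain of $g$ of the absolute values of all partial derivatives of $g$ of order at most $k$; $C^k_1$ denotes the set of $C^k$ functions with $|g|_k\le 1$. Let $r\in\mathbb N$, $R>0$, $L\ge 0$, $\varpi>0$. There exist constants $\kappa,\varepsilon_0,C>0$, depending only on $r,R,L,\varpi$, with the following property. Let $l\ge 1$ be an integer with $r\ge 2(l+1)+3$, let $h\in C^{l+3}_1(B_R)$ with gradient $\nabla h=\omega=(\omega_1,\omega_2)$, let $f\in C^r_1(\mathbb T^2\times B_R)$, and assume: (B.1) $S_1\subseteq[-R,R]$ is a closed segment with $\omega_1(I_1,0)=0$ for all $I_1\in S_1$; (B.2) $S_1^*\subseteq S_1$ is a closed segment of length $L$ with $\omega_2(I_1,0)\ge\varpi$ for all $I_1\in S_1^*$. Put $S^*=S_1^*\times\{0\}$, $S^*(\rho)=\{I\in\mathbb R^2: d(I,S^*)\le\rho\}$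 (distance for $|\cdot|$) and $\mathcal D^*(\rho)=\mathbb T^2\times S^*(\rho)$. Let $0<\varepsilon\le\varepsilon_0$ be such that $S^*(\kappa\varepsilon)\subseteq B_R$, and let $H=h+\varepsilon f$ on $\mathbb T^2\times B_R$. Then there exist a symplectic embedding $\Phi:\mathcal D^*(\kappa\varepsilon/2)\to\mathcal D^*(\kappa\varepsilon)$ of class $C^{l+1}$ (for the form $d\theta_1\wedge dI_1+d\theta_2\wedge dI_2$) and a $C^l$ function $f':\mathcal D^*(\kappa\varepsilon/2)\to\mathbb R$ such that on $\mathcal D^*(\kappa\varepsilon/2)$ \[ H\circ\Phi=h+\varepsilon\bar f+\varepsilon^2 f',\qquad \bar f(\theta_1,I)=\int_{\mathbb T}f(\theta_1,\theta_2,I)\,d\theta_2, \] and \[ |\Phi-\mathrm{Id}|_0\le\kappa\varepsilon/2,\qquad |f'|_l\le C, \] where $\Phi-\mathrm{Id}$ is computed on a suitable lift of $\Phi$ to $\mathbb R^2\times S^*(\kappa\varepsilon/2)$. -/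

import Mathlib

open scoped ENNReal

namespace NearIntegrable

/-- The space of actions `ℝ²`, with the supremum norm.  Index `0` is `I₁`, index `1` is `I₂`. -/
abbrev Action : Type := Fin 2 → ℝ

/-- The torus `𝕋² = ℝ² / ℤ²` of angles.  Index `0` is `θ₁`, index `1` is `θ₂`. -/
abbrev Torus : Type := Fin 2 → UnitAddCircle

/-- The phase space `𝕋² × ℝ²`, with points `(θ, I)`. -/
abbrev Phase : Type := Torus × Action

/-- The universal cover `ℝ² × ℝ²` of the phase space, with the supremum norm. -/
abbrev Cover : Type := (Fin 2 → ℝ) × Action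

/-- The covering map `ℝ² × ℝ² → 𝕋² × ℝ²`. -/
def proj (x : Cover) : Phase := (fun i => (x.1 i : UnitAddCircle), x.2)

/-- The standard basis of the space of actions. -/
noncomputable def actionBasis : Module.Basis (Fin 2) ℝ Action := Pi.basisFun ℝ (Fin 2)

/-- The standard basis of `ℝ² × ℝ²`. -/
noncomputable def coverBasis : Module.Basis (Fin 2 ⊕ Fin 2) ℝ Cover :=
  (Pi.basisFun ℝ (Fin 2)).prod (Pi.basisFun ℝ (Fin 2))

/-- The `C^k` norm of `F` on `D`: the supremum over `D` of the absolute values of all partial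
derivatives of order at most `k` with respect to the coordinates of the basis `b`.  The sets `D`
used below are closed, convex, with nonempty interior, so derivatives within `D` are unique. -/
noncomputable def ckNorm {ι E : Type*} [NormedAddCommGroup E] [NormedSpace ℝ E]
    (b : Module.Basis ι ℝ E) (k : ℕ) (D : Set E) (F : E → ℝ) : ℝ≥0∞ :=
  ⨆ (m : ℕ) (_ : m ≤ k) (σ : Fin m → ι) (x : E) (_ : x ∈ D),
    ‖iteratedFDerivWithin ℝ m F D x (fun i => b (σ i))‖ₑ

/-- `F` is of class `C^k` on `D` with `C^k` norm at most `C`. -/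
def InCkBall {ι E : Type*} [NormedAddCommGroup E] [NormedSpace ℝ E]
    (b : Module.Basis ι ℝ E) (k : ℕ) (D : Set E) (C : ℝ) (F : E → ℝ) : Prop :=
  ContDiffOn ℝ k F D ∧ ckNorm b k D F ≤ ENNReal.ofReal C

/-- A function `g` on the action domain `A` is of class `C^k` with norm at most `C`. -/
def ActionCkBall (k : ℕ) (A : Set Action) (C : ℝ) (g : Action → ℝ) : Prop :=
  InCkBall actionBasis k A C g

/-- A function `g` on `𝕋² × A` is of class `C^k` with norm at most `C`; derivatives are taken in
the angle-action coordinates, that is, on the universal cover. -/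
def PhaseCkBall (k : ℕ) (A : Set Action) (C : ℝ) (g : Phase → ℝ) : Prop :=
  InCkBall coverBasis k (Set.univ ×ˢ A) C (g ∘ proj)

/-- The closed ball `B_R = [-R, R]²` of the supremum norm. -/
def ball (R : ℝ) : Set Action := Metric.closedBall 0 R

/-- The frequency component `ω_i = ∂h / ∂I_i` of a function `h` on `B_R`. -/
noncomputable def freq (R : ℝ) (h : Action → ℝ) (i : Fin 2) (I : Action) : ℝ :=
  fderivWithin ℝ h (ball R) I (Pi.single i 1)

/-- The resonant segment `S* = S₁* × {0}` where `S₁* = [a, b]`. -/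
def segment (a b : ℝ) : Set Action := {I | I 0 ∈ Set.Icc a b ∧ I 1 = 0}

/-- The closed neighbourhood `S*(ρ) = {I | d(I, S*) ≤ ρ}` (distance of the supremum norm). -/
def segmentNhd (a b ρ : ℝ) : Set Action := Metric.cthickening ρ (segment a b)

/-- The domain `𝒟*(ρ) = 𝕋² × S*(ρ)`. -/
def domain (a b ρ : ℝ) : Set Phase := Set.univ ×ˢ segmentNhd a b ρ

/-- The Hamiltonian `H = h + ε f`. -/
def hamiltonian (h : Action → ℝ) (ε : ℝ) (f : Phase → ℝ) (z : Phase) : ℝ :=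
  h z.2 + ε * f z

/-- The average `f̄(θ₁, I) = ∫_𝕋 f(θ₁, θ₂, I) dθ₂`. -/
noncomputable def average (f : Phase → ℝ) (θ₁ : UnitAddCircle) (I : Action) : ℝ :=
  ∫ θ₂ : UnitAddCircle, f (![θ₁, θ₂], I)

/-- The standard symplectic form `dθ₁ ∧ dI₁ + dθ₂ ∧ dI₂`. -/
def symplecticForm (u v : Cover) : ℝ := ∑ i, (u.1 i * v.2 i - u.2 i * v.1 i)

/-- `Φ` is a symplectic embedding of class `C^k` of `𝕋² × A` into `𝕋² × ℝ²`, and `Ψ` is a lift of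
it to the universal covers.  (Preservation of the symplectic form makes `Φ` an immersion.) -/
structure IsSymplecticEmbedding (k : ℕ) (A : Set Action) (Φ : Phase → Phase) (Ψ : Cover → Cover) :
    Prop where
  lift : ∀ x ∈ (Set.univ : Set (Fin 2 → ℝ)) ×ˢ A, proj (Ψ x) = Φ (proj x)
  contDiffOn : ContDiffOn ℝ k Ψ (Set.univ ×ˢ A)
  symplectic : ∀ x ∈ (Set.univ : Set (Fin 2 → ℝ)) ×ˢ A, ∀ u v : Cover,
    symplecticForm (fderivWithin ℝ Ψ (Set.univ ×ˢ A) x u) (fderivWithin ℝ Ψ (Set.univ ×ˢ A) x v) =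
      symplecticForm u v
  isEmbedding : Topology.IsEmbedding (((Set.univ : Set Torus) ×ˢ A).domRestrict Φ)

end NearIntegrable

namespace NearIntegrable

open Set Topology

/-! ### Calculus of families with uniform C^k bounds. -/

section UniformBounds

variable {P E G G' H : Type} [NormedAddCommGroup E] [NormedSpace ℝ E]
  [NormedAddCommGroup G] [NormedSpace ℝ G] [NormedAddCommGroup G'] [NormedSpace ℝ G']
  [NormedAddCommGroup H] [NormedSpace ℝ H]

/-- The functions `F p` of the family `F` are of class `C^k` on the open sets `U p`, with
derivatives of orders `j, …, k` bounded uniformly in `p`. -/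
structure UnifCk (j k : ℕ) (U : P → Set E) (F : P → E → G) : Prop where
  isOpen : ∀ p, IsOpen (U p)
  contDiffOn : ∀ p, ContDiffOn ℝ k (F p) (U p)
  bdd : ∃ C : ℝ, ∀ p, ∀ x ∈ U p, ∀ m, j ≤ m → m ≤ k → ‖iteratedFDeriv ℝ m (F p) x‖ ≤ C

namespace UnifCk

variable {j k : ℕ} {U : P → Set E} {F F₁ F₂ : P → E → G}

theorem mono_order {j' k' : ℕ} (h : UnifCk j k U F) (hj : j ≤ j') (hk : k' ≤ k) :
    UnifCk j' k' U F := by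
  obtain ⟨C, hC⟩ := h.bdd
  exact ⟨h.isOpen, fun p => (h.contDiffOn p).of_le (by exact_mod_cast hk),
    C, fun p x hx m h1 h2 => hC p x hx m (hj.trans h1) (h2.trans hk)⟩

theorem mono_set {V : P → Set E} (h : UnifCk j k U F) (hV : ∀ p, IsOpen (V p))
    (hVU : ∀ p, V p ⊆ U p) : UnifCk j k V F := by
  obtain ⟨C, hC⟩ := h.bdd
  exact ⟨hV, fun p => (h.contDiffOn p).mono (hVU p), C, fun p x hx => hC p x (hVU p hx)⟩

theorem reindex {Q : Type} (h : UnifCk j k U F) (φ : Q → P) :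
    UnifCk j k (fun q => U (φ q)) (fun q => F (φ q)) := by
  obtain ⟨C, hC⟩ := h.bdd
  exact ⟨fun q => h.isOpen _, fun q => h.contDiffOn _, C, fun q => hC _⟩

theorem congr (h : UnifCk j k U F₁) (hF : ∀ p, ∀ x ∈ U p, F₂ p x = F₁ p x) :
    UnifCk j k U F₂ := by
  obtain ⟨C, hC⟩ := h.bdd
  refine ⟨h.isOpen, fun p => (h.contDiffOn p).congr (hF p), C, fun p x hx m h1 h2 => ?_⟩
  have : F₂ p =ᶠ[𝓝 x] F₁ p :=
    Filter.eventuallyEq_of_mem ((h.isOpen p).mem_nhds hx) (hF p)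
  rw [(this.iteratedFDeriv ℝ m).eq_of_nhds]
  exact hC p x hx m h1 h2

theorem differentiableAt (h : UnifCk j k U F) (hk : 1 ≤ k) {p : P} {x : E} (hx : x ∈ U p) :
    DifferentiableAt ℝ (F p) x :=
  ((h.contDiffOn p).contDiffAt ((h.isOpen p).mem_nhds hx)).differentiableAt
    (by exact_mod_cast (Nat.one_le_iff_ne_zero.1 hk))

theorem norm_le (h : UnifCk 0 k U F) : ∃ C : ℝ, 0 < C ∧ ∀ p, ∀ x ∈ U p, ‖F p x‖ ≤ C := by
  obtain ⟨C, hC⟩ := h.bdd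
  refine ⟨max C 1, by positivity, fun p x hx => ?_⟩
  have := hC p x hx 0 le_rfl (Nat.zero_le _)
  rw [norm_iteratedFDeriv_zero] at this
  exact this.trans (le_max_left _ _)

theorem fderiv_one (h : UnifCk 1 (k + 1) U F) : UnifCk 0 k U (fun p => fderiv ℝ (F p)) := by
  obtain ⟨C, hC⟩ := h.bdd
  refine ⟨h.isOpen, fun p => (h.contDiffOn p).fderiv_of_isOpen (h.isOpen p) (by norm_cast), C,
    fun p x hx m h1 h2 => ?_⟩
  rw [norm_iteratedFDeriv_fderiv]
  exact hC p x hx _ (by omega) (by omega)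

theorem fderiv (h : UnifCk 0 (k + 1) U F) : UnifCk 0 k U (fun p => fderiv ℝ (F p)) :=
  fderiv_one (h.mono_order (Nat.zero_le _) le_rfl)

theorem of_fderiv_one (hU : ∀ p, IsOpen (U p)) (hd : ∀ p, ∀ x ∈ U p, DifferentiableAt ℝ (F p) x)
    (h : UnifCk 0 k U (fun p => _root_.fderiv ℝ (F p))) : UnifCk 1 (k + 1) U F := by
  obtain ⟨C, hC⟩ := h.bdd
  refine ⟨hU, fun p => ?_, C, fun p x hx m h1 h2 => ?_⟩
  · have := (contDiffOn_succ_iff_fderiv_of_isOpen (n := (k : WithTop ℕ∞)) (𝕜 := ℝ) (f := F p)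
      (hU p)).2 ⟨fun x hx => (hd p x hx).differentiableWithinAt, by simp, h.contDiffOn p⟩
    exact_mod_cast this
  · obtain ⟨m, rfl⟩ : ∃ m', m = m' + 1 := ⟨m - 1, by omega⟩
    rw [← norm_iteratedFDeriv_fderiv]
    exact hC p x hx m (Nat.zero_le _) (by omega)

theorem of_one {C : ℝ} (h : UnifCk 1 k U F) (h0 : ∀ p, ∀ x ∈ U p, ‖F p x‖ ≤ C) :
    UnifCk 0 k U F := by
  obtain ⟨C', hC⟩ := h.bdd
  refine ⟨h.isOpen, h.contDiffOn, max C C', fun p x hx m h1 h2 => ?_⟩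
  rcases Nat.eq_zero_or_pos m with rfl | hm
  · rw [norm_iteratedFDeriv_zero]
    exact (h0 p x hx).trans (le_max_left _ _)
  · exact (hC p x hx m hm h2).trans (le_max_right _ _)

theorem of_fderiv {C : ℝ} (hU : ∀ p, IsOpen (U p))
    (hd : ∀ p, ∀ x ∈ U p, DifferentiableAt ℝ (F p) x) (h0 : ∀ p, ∀ x ∈ U p, ‖F p x‖ ≤ C)
    (h : UnifCk 0 k U (fun p => _root_.fderiv ℝ (F p))) : UnifCk 0 (k + 1) U F :=
  of_one (of_fderiv_one hU hd h) h0

theorem of_continuousOn {C : ℝ} (hU : ∀ p, IsOpen (U p)) (hc : ∀ p, ContinuousOn (F p) (U p))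
    (h0 : ∀ p, ∀ x ∈ U p, ‖F p x‖ ≤ C) : UnifCk 0 0 U F := by
  refine ⟨hU, fun p => by simpa using hc p, C, fun p x hx m h1 h2 => ?_⟩
  obtain rfl : m = 0 := by omega
  rw [norm_iteratedFDeriv_zero]
  exact h0 p x hx

theorem const (hU : ∀ p, IsOpen (U p)) {c : P → G} {C : ℝ} (hc : ∀ p, ‖c p‖ ≤ C) :
    UnifCk 0 k U (fun p _ => c p) := by
  refine ⟨hU, fun p => contDiffOn_const, C, fun p x hx m _ _ => ?_⟩
  rcases Nat.eq_zero_or_pos m with rfl | hm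
  · rw [norm_iteratedFDeriv_zero]; exact hc p
  · rw [iteratedFDeriv_const_of_ne (by omega)]
    simpa using (norm_nonneg _).trans (hc p)

theorem clm_one (hU : ∀ p, IsOpen (U p)) (L : P → E →L[ℝ] G) {C : ℝ} (hL : ∀ p, ‖L p‖ ≤ C) :
    UnifCk 1 k U (fun p x => L p x) := by
  have : UnifCk 1 (k + 1) U (fun p x => L p x) := by
    refine of_fderiv_one hU (fun p x _ => (L p).differentiableAt) ?_
    refine (const (c := L) hU hL).congr fun p x _ => ?_
    exact (L p).fderiv
  exact this.mono_order le_rfl (Nat.le_succ _)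

theorem add (h₁ : UnifCk j k U F₁) (h₂ : UnifCk j k U F₂) :
    UnifCk j k U (fun p x => F₁ p x + F₂ p x) := by
  obtain ⟨C₁, hC₁⟩ := h₁.bdd
  obtain ⟨C₂, hC₂⟩ := h₂.bdd
  refine ⟨h₁.isOpen, fun p => (h₁.contDiffOn p).add (h₂.contDiffOn p), C₁ + C₂,
    fun p x hx m hm hm' => ?_⟩
  have hn := (h₁.isOpen p).mem_nhds hx
  have e := iteratedFDeriv_add_apply (i := m) (x := x)
    (((h₁.contDiffOn p).contDiffAt hn).of_le (by exact_mod_cast hm'))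
    (((h₂.contDiffOn p).contDiffAt hn).of_le (by exact_mod_cast hm'))
  change ‖iteratedFDeriv ℝ m (F₁ p + F₂ p) x‖ ≤ _
  rw [e]
  exact (norm_add_le _ _).trans (add_le_add (hC₁ p x hx m hm hm') (hC₂ p x hx m hm hm'))

theorem clm_comp (L : G →L[ℝ] H) (h : UnifCk j k U F) : UnifCk j k U (fun p x => L (F p x)) := by
  obtain ⟨C, hC⟩ := h.bdd
  refine ⟨h.isOpen, fun p => L.contDiff.comp_contDiffOn (h.contDiffOn p), ‖L‖ * C,
    fun p x hx m hm hm' => ?_⟩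
  have hn := (h.isOpen p).mem_nhds hx
  have e := L.iteratedFDeriv_comp_left (((h.contDiffOn p).contDiffAt hn))
    (i := m) (by exact_mod_cast hm')
  change ‖iteratedFDeriv ℝ m (L ∘ F p) x‖ ≤ _
  rw [e]
  exact (L.norm_compContinuousMultilinearMap_le _).trans
    (mul_le_mul_of_nonneg_left (hC p x hx m hm hm') (norm_nonneg _))

theorem neg (h : UnifCk j k U F) : UnifCk j k U (fun p x => -F p x) :=
  h.clm_comp (-ContinuousLinearMap.id ℝ G)

theorem sub (h₁ : UnifCk j k U F₁) (h₂ : UnifCk j k U F₂) :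
    UnifCk j k U (fun p x => F₁ p x - F₂ p x) := by
  simpa [sub_eq_add_neg] using h₁.add h₂.neg

/-- Induction on the order through the Leibniz rule: both terms of the derivative are again bilinear
expressions, with other target spaces, so the spaces vary in the induction. -/
theorem bilin (B : G →L[ℝ] G' →L[ℝ] H) {F' : P → E → G'} (h₁ : UnifCk 0 k U F)
    (h₂ : UnifCk 0 k U F') : UnifCk 0 k U (fun p x => B (F p x) (F' p x)) := by
  induction k generalizing G G' H with
  | zero =>
    obtain ⟨C₁, hC₁, h1⟩ := h₁.norm_le
    obtain ⟨C₂, hC₂, h2⟩ := h₂.norm_le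
    refine of_continuousOn (C := ‖B‖ * C₁ * C₂) h₁.isOpen (fun p => ?_) fun p x hx => ?_
    · exact (B.continuous.comp_continuousOn (h₁.contDiffOn p).continuousOn).clm_apply
        (h₂.contDiffOn p).continuousOn
    · refine (B.le_opNorm₂ _ _).trans ?_
      gcongr
      exacts [h1 p x hx, h2 p x hx]
  | succ k ih =>
    obtain ⟨C₁, hC₁, h1⟩ := h₁.norm_le
    obtain ⟨C₂, hC₂, h2⟩ := h₂.norm_le
    refine of_fderiv (C := ‖B‖ * C₁ * C₂) h₁.isOpen (fun p x hx => ?_) (fun p x hx => ?_) ?_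
    · exact (B.hasFDerivAt_of_bilinear (h₁.differentiableAt (by omega) hx).hasFDerivAt
        (h₂.differentiableAt (by omega) hx).hasFDerivAt).differentiableAt
    · refine (B.le_opNorm₂ _ _).trans ?_
      gcongr
      exacts [h1 p x hx, h2 p x hx]
    · have a1 := ih (B.precompR E) (h₁.mono_order le_rfl (Nat.le_succ _)) h₂.fderiv
      have a2 := ih (B.precompL E) h₁.fderiv (h₂.mono_order le_rfl (Nat.le_succ _))
      refine (a1.add a2).congr fun p x hx => ?_
      exact B.fderiv_of_bilinear (h₁.differentiableAt (by omega) hx)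
        (h₂.differentiableAt (by omega) hx)

theorem smul {c : P → E → ℝ} (h₁ : UnifCk 0 k U c) (h₂ : UnifCk 0 k U F) :
    UnifCk 0 k U (fun p x => c p x • F p x) :=
  bilin (ContinuousLinearMap.lsmul ℝ ℝ) h₁ h₂

theorem mul {𝔸 : Type} [NormedRing 𝔸] [NormedAlgebra ℝ 𝔸] {a b : P → E → 𝔸}
    (h₁ : UnifCk 0 k U a) (h₂ : UnifCk 0 k U b) : UnifCk 0 k U (fun p x => a p x * b p x) :=
  bilin (ContinuousLinearMap.mul ℝ 𝔸) h₁ h₂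

theorem pow {a : P → E → ℝ} (h : UnifCk 0 k U a) (n : ℕ) :
    UnifCk 0 k U (fun p x => a p x ^ n) := by
  induction n with
  | zero => simpa using const (C := 1) (c := fun _ => (1 : ℝ)) h.isOpen (by simp)
  | succ n ih => simpa [pow_succ] using ih.mul h

theorem sum {ι : Type} (s : Finset ι) {A : ι → P → E → G} (hU : ∀ p, IsOpen (U p))
    (h : ∀ i ∈ s, UnifCk 0 k U (A i)) : UnifCk 0 k U (fun p x => ∑ i ∈ s, A i p x) := by
  classical
  induction s using Finset.induction_on with
  | empty => simpa using const (C := 0) (c := fun _ => (0 : G)) hU (by simp)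
  | insert i s hi ih =>
    simp only [Finset.sum_insert hi]
    exact (h i (Finset.mem_insert_self _ _)).add
      (ih fun i' hi' => h i' (Finset.mem_insert_of_mem hi'))

/-- Composition with an inner function all of whose derivatives of positive order are bounded. -/
theorem comp {V : P → Set G} {g : P → G → H} (hg : UnifCk 0 k V g) (hF : UnifCk 1 k U F)
    (hm : ∀ p, MapsTo (F p) (U p) (V p)) : UnifCk 0 k U (fun p x => g p (F p x)) := by
  induction k generalizing H with
  | zero =>
    obtain ⟨C, _, hC⟩ := hg.norm_le
    exact of_continuousOn hF.isOpen
      (fun p => (hg.contDiffOn p).continuousOn.comp (hF.contDiffOn p).continuousOn (hm p))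
      fun p x hx => hC p _ (hm p hx)
  | succ k ih =>
    obtain ⟨C, _, hC⟩ := hg.norm_le
    have hd : ∀ p, ∀ x ∈ U p, HasFDerivAt (fun x => g p (F p x))
        ((_root_.fderiv ℝ (g p) (F p x)).comp (_root_.fderiv ℝ (F p) x)) x := fun p x hx =>
      (hg.differentiableAt (by omega) (hm p hx)).hasFDerivAt.comp x
        (hF.differentiableAt (by omega) hx).hasFDerivAt
    refine of_fderiv hF.isOpen (fun p x hx => (hd p x hx).differentiableAt)
      (fun p x hx => hC p _ (hm p hx)) ?_
    have a1 := ih hg.fderiv (hF.mono_order le_rfl (Nat.le_succ _))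
    refine (bilin (ContinuousLinearMap.compL ℝ E G H) a1 hF.fderiv_one).congr fun p x hx => ?_
    exact (hd p x hx).fderiv

/-- A bounded inverse of a family in a normed algebra. -/
theorem of_mul_eq_one {𝔸 : Type} [NormedRing 𝔸] [NormedAlgebra ℝ 𝔸] {a b : P → E → 𝔸} {C : ℝ}
    (ha : UnifCk 0 k U a) (hb : ∀ p, ContDiffOn ℝ k (b p) (U p))
    (hbC : ∀ p, ∀ x ∈ U p, ‖b p x‖ ≤ C) (hab : ∀ p, ∀ x ∈ U p, a p x * b p x = 1)
    (hba : ∀ p, ∀ x ∈ U p, b p x * a p x = 1) : UnifCk 0 k U b := by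
  induction k with
  | zero => exact of_continuousOn ha.isOpen (fun p => (hb p).continuousOn) hbC
  | succ k ih =>
    have hb' := ih (ha.mono_order le_rfl (Nat.le_succ _))
      fun p => (hb p).of_le (by exact_mod_cast Nat.le_succ k)
    have hd : ∀ p, ∀ x ∈ U p, DifferentiableAt ℝ (b p) x := fun p x hx =>
      ((hb p).contDiffAt ((ha.isOpen p).mem_nhds hx)).differentiableAt (by norm_cast)
    refine of_fderiv ha.isOpen hd hbC ?_
    -- Differentiating a b = 1 gives b' = -b a' b, so bounds of order k on b yield bounds of order k
    -- + 1.
    have c1 := bilin (ContinuousLinearMap.compL ℝ E 𝔸 𝔸)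
      (hb'.clm_comp (ContinuousLinearMap.mul ℝ 𝔸)) ha.fderiv
    have c2 := bilin (ContinuousLinearMap.compL ℝ E 𝔸 𝔸)
      (hb'.clm_comp (ContinuousLinearMap.mul ℝ 𝔸).flip) c1
    refine c2.neg.congr fun p x hx => ?_
    have key := (ContinuousLinearMap.mul ℝ 𝔸).hasFDerivAt_of_bilinear
      (ha.differentiableAt (by omega) hx).hasFDerivAt (hd p x hx).hasFDerivAt
    have key2 : HasFDerivAt (fun y => ContinuousLinearMap.mul ℝ 𝔸 (a p y) (b p y))
        (0 : E →L[ℝ] 𝔸) x := by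
      refine (hasFDerivAt_const (1 : 𝔸) x).congr_of_eventuallyEq ?_
      filter_upwards [(ha.isOpen p).mem_nhds hx] with y hy
      simpa using hab p y hy
    ext v
    have e := DFunLike.congr_fun (key.unique key2) v
    simp at e ⊢
    have e2 : b p x * (a p x * (_root_.fderiv ℝ (b p) x) v + (_root_.fderiv ℝ (a p) x) v * b p x)
        = 0 := by rw [e, mul_zero]
    rw [mul_add, ← mul_assoc, hba p x hx, one_mul, ← mul_assoc] at e2
    exact eq_neg_of_add_eq_zero_left e2

theorem inv {a : P → E → ℝ} {c : ℝ} (hc : 0 < c) (ha : UnifCk 0 k U a)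
    (h : ∀ p, ∀ x ∈ U p, c ≤ a p x) : UnifCk 0 k U (fun p x => (a p x)⁻¹) := by
  have hne : ∀ p, ∀ x ∈ U p, a p x ≠ 0 := fun p x hx => (hc.trans_le (h p x hx)).ne'
  refine of_mul_eq_one (C := c⁻¹) ha (fun p => (ha.contDiffOn p).inv (hne p)) (fun p x hx => ?_)
    (fun p x hx => mul_inv_cancel₀ (hne p x hx)) fun p x hx => inv_mul_cancel₀ (hne p x hx)
  rw [norm_inv, Real.norm_of_nonneg (hc.le.trans (h p x hx))]
  exact inv_anti₀ hc (h p x hx)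

/-- If `a = O(ε)` then `a ^ (n + 1) / ε` is bounded in `C^n`, although `a / ε` need not be. -/
theorem pow_succ_div {a : P → E → ℝ} {ε : P → ℝ} {C : ℝ} {n : ℕ} (hn : n ≤ k)
    (ha : UnifCk 0 k U a) (hε : ∀ p, 0 < ε p) (h : ∀ p, ∀ x ∈ U p, |a p x| ≤ C * ε p) :
    UnifCk 0 n U (fun p x => a p x ^ (n + 1) / ε p) := by
  obtain ⟨D, hD, hD'⟩ := ha.norm_le
  have h0 : ∀ n : ℕ, ∀ p, ∀ x ∈ U p, ‖a p x ^ (n + 1) / ε p‖ ≤ D ^ n * C := by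
    intro n p x hx
    rw [norm_div, norm_pow, pow_succ, Real.norm_of_nonneg (hε p).le, mul_div_assoc]
    have h1 := hD' p x hx
    have h2 : ‖a p x‖ / ε p ≤ C := by
      rw [div_le_iff₀ (hε p)]; exact h p x hx
    have h3 : 0 ≤ ‖a p x‖ / ε p := div_nonneg (norm_nonneg _) (hε p).le
    gcongr
  induction n with
  | zero =>
    refine of_continuousOn ha.isOpen (fun p => ?_) (h0 0)
    exact ((ha.contDiffOn p).continuousOn.pow _).div_const _
  | succ n ih =>
    -- A derivative costs one power: it leaves a^(n+1)/ε, covered by induction, times the bounded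
    -- factor Da.
    have hd : ∀ p, ∀ x ∈ U p, HasFDerivAt (fun x => a p x ^ (n + 1 + 1) / ε p)
        (((n + 2 : ℝ) * (a p x ^ (n + 1) / ε p)) • _root_.fderiv ℝ (a p) x) x := by
      intro p x hx
      have := ((ha.differentiableAt (by omega) hx).hasFDerivAt.pow (n + 1 + 1)).mul_const (ε p)⁻¹
      simp only [div_eq_mul_inv]
      refine this.congr_fderiv ?_
      ext v
      simp
      ring
    refine of_fderiv ha.isOpen (fun p x hx => (hd p x hx).differentiableAt) (h0 _) ?_
    have c := (const (k := n) (c := fun _ : P => (n + 2 : ℝ)) (C := ‖(n + 2 : ℝ)‖) ha.isOpen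
      (fun _ => le_rfl)).mul (ih (by omega))
    have ha' : UnifCk 0 (n + 1) U a := ha.mono_order le_rfl hn
    exact (c.smul ha'.fderiv).congr fun p x hx => (hd p x hx).fderiv

end UnifCk

end UniformBounds


/-! ### Integrals depending on a parameter. -/

section ParametricIntegral

variable {P E G : Type} [NormedAddCommGroup E] [NormedSpace ℝ E]
  [NormedAddCommGroup G] [NormedSpace ℝ G]

/-- Dominated differentiation, the uniform bound on the derivative being the dominating constant.
The interval (-1, 2) serves as an open neighbourhood of [0, 1]. -/
theorem hasFDerivAt_integral_of_unifCk {k : ℕ} {U : P → Set E} {F : P → E × ℝ → G}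
    (h : UnifCk 0 (k + 1) (fun p => U p ×ˢ Ioo (-1 : ℝ) 2) F) (hU : ∀ p, IsOpen (U p))
    (p : P) {x : E} (hx : x ∈ U p) :
    HasFDerivAt (fun x => ∫ s in (0 : ℝ)..1, F p (x, s))
      (∫ s in (0 : ℝ)..1, (fderiv ℝ (F p) (x, s)).comp (ContinuousLinearMap.inl ℝ E ℝ)) x := by
  obtain ⟨C, _, hC⟩ := h.fderiv.norm_le
  have hsub : ∀ {s : ℝ}, s ∈ uIoc (0 : ℝ) 1 → s ∈ Ioo (-1 : ℝ) 2 := by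
    intro s hs
    rw [uIoc_of_le zero_le_one] at hs
    exact ⟨by linarith [hs.1], by linarith [hs.2]⟩
  have hsub' : uIcc (0 : ℝ) 1 ⊆ Ioo (-1 : ℝ) 2 := by
    rw [uIcc_of_le zero_le_one]
    exact fun s hs => ⟨by linarith [hs.1], by linarith [hs.2]⟩
  have hc : ∀ y ∈ U p, ContinuousOn (fun s => F p (y, s)) (Ioo (-1 : ℝ) 2) := fun y hy =>
    (h.contDiffOn p).continuousOn.comp (by fun_prop) fun s hs => ⟨hy, hs⟩
  have hc' : ContinuousOn (fun s => (fderiv ℝ (F p) (x, s)).comp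
      (ContinuousLinearMap.inl ℝ E ℝ)) (Ioo (-1 : ℝ) 2) := by
    have : ContinuousOn (fun s => fderiv ℝ (F p) (x, s)) (Ioo (-1 : ℝ) 2) :=
      (h.fderiv.contDiffOn p).continuousOn.comp (by fun_prop) fun s hs => ⟨hx, hs⟩
    exact this.clm_comp continuousOn_const
  refine intervalIntegral.hasFDerivAt_integral_of_dominated_of_fderiv_le (s := U p)
    (bound := fun _ => C * ‖ContinuousLinearMap.inl ℝ E ℝ‖)
    (F' := fun y s => (fderiv ℝ (F p) (y, s)).comp (ContinuousLinearMap.inl ℝ E ℝ))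
    ((hU p).mem_nhds hx) ?_ ?_ ?_ ?_ ?_ ?_
  · filter_upwards [(hU p).mem_nhds hx] with y hy
    exact ((hc y hy).mono fun s hs => hsub hs).aestronglyMeasurable measurableSet_uIoc
  · exact ((hc x hx).mono hsub').intervalIntegrable
  · exact (hc'.mono fun s hs => hsub hs).aestronglyMeasurable measurableSet_uIoc
  · refine Filter.Eventually.of_forall fun s hs y hy => ?_
    refine (ContinuousLinearMap.opNorm_comp_le _ _).trans ?_
    gcongr
    exact hC p (y, s) ⟨hy, hsub hs⟩
  · exact intervalIntegrable_const
  · refine Filter.Eventually.of_forall fun s hs y hy => ?_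
    have h1 := (h.differentiableAt (by omega) (p := p) (x := (y, s)) ⟨hy, hsub hs⟩).hasFDerivAt
    have h2 : HasFDerivAt (fun y : E => (y, s)) (ContinuousLinearMap.inl ℝ E ℝ) y :=
      hasFDerivAt_prodMk_left y s
    exact h1.comp y h2

/-- Integrals depending on a parameter are uniformly of class `C^k`. -/
theorem UnifCk.integral {k : ℕ} {U : P → Set E} {F : P → E × ℝ → G}
    (h : UnifCk 0 k (fun p => U p ×ˢ Ioo (-1 : ℝ) 2) F) (hU : ∀ p, IsOpen (U p)) :
    UnifCk 0 k U (fun p x => ∫ s in (0 : ℝ)..1, F p (x, s)) := by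
  have hsub : ∀ {s : ℝ}, s ∈ uIoc (0 : ℝ) 1 → s ∈ Ioo (-1 : ℝ) 2 := by
    intro s hs
    rw [uIoc_of_le zero_le_one] at hs
    exact ⟨by linarith [hs.1], by linarith [hs.2]⟩
  induction k generalizing G with
  | zero =>
    obtain ⟨C, _, hC⟩ := h.norm_le
    refine of_continuousOn (C := C) hU (fun p x hx => ContinuousAt.continuousWithinAt ?_)
      fun p x hx => ?_
    · refine intervalIntegral.continuousAt_of_dominated_interval (bound := fun _ => C) ?_ ?_
        intervalIntegrable_const ?_
      · filter_upwards [(hU p).mem_nhds hx] with y hy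
        have hc : ContinuousOn (fun s => F p (y, s)) (Ioo (-1 : ℝ) 2) :=
          (h.contDiffOn p).continuousOn.comp (by fun_prop) fun s hs => ⟨hy, hs⟩
        exact (hc.mono fun s hs => hsub hs).aestronglyMeasurable measurableSet_uIoc
      · filter_upwards [(hU p).mem_nhds hx] with y hy
        exact Filter.Eventually.of_forall fun s hs => hC p (y, s) ⟨hy, hsub hs⟩
      · refine Filter.Eventually.of_forall fun s hs => ?_
        have h1 : ContinuousAt (F p) (x, s) := (h.contDiffOn p).continuousOn.continuousAt
          ((h.isOpen p).mem_nhds ⟨hx, hsub hs⟩)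
        exact ContinuousAt.comp (f := fun y : E => (y, s)) h1 (by fun_prop)
    · refine (intervalIntegral.norm_integral_le_of_norm_le_const fun s hs =>
        hC p (x, s) ⟨hx, hsub hs⟩).trans ?_
      simp
  | succ k ih =>
    obtain ⟨C, _, hC⟩ := h.norm_le
    refine of_fderiv (C := C) hU (fun p x hx =>
      (hasFDerivAt_integral_of_unifCk h hU p hx).differentiableAt) (fun p x hx => ?_) ?_
    · refine (intervalIntegral.norm_integral_le_of_norm_le_const fun s hs =>
        hC p (x, s) ⟨hx, hsub hs⟩).trans ?_
      simp
    · have := ih (h.fderiv.clm_comp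
        ((ContinuousLinearMap.compL ℝ E (E × ℝ) G).flip (ContinuousLinearMap.inl ℝ E ℝ)))
      refine this.congr fun p x hx => ?_
      rw [(hasFDerivAt_integral_of_unifCk h hU p hx).fderiv]
      rfl

end ParametricIntegral


/-! ### Inversion of perturbations of the identity. -/

section NearIdentity

variable {P E : Type} [NormedAddCommGroup E] [NormedSpace ℝ E]

/-- By the mean value inequality on a convex set, g is 1/2-Lipschitz. -/
theorem approximatesLinearOn_id_add {W : Set E} {g : E → E} (hc : Convex ℝ W)
    (hg : ∀ x ∈ W, DifferentiableAt ℝ g x) (hb : ∀ x ∈ W, ‖fderiv ℝ g x‖ ≤ 1 / 2) :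
    ApproximatesLinearOn (fun x => x + g x) (ContinuousLinearEquiv.refl ℝ E : E →L[ℝ] E) W
      (1 / 2) := by
  intro x hx y hy
  have := hc.norm_image_sub_le_of_norm_fderiv_le hg hb hy hx
  have e : x + g x - (y + g y) - (ContinuousLinearEquiv.refl ℝ E : E →L[ℝ] E) (x - y)
      = g x - g y := by
    simp; abel
  rw [e]
  simpa using this

/-- The smallness condition of the quantitative inverse function theorem for the Lipschitz constant
1/2: the inverse of the identity has norm 1 unless the space is trivial. -/
theorem subsingleton_or_half_lt :
    Subsingleton E ∨ (1 / 2 : NNReal) < ‖((ContinuousLinearEquiv.refl ℝ E).symm : E →L[ℝ] E)‖₊⁻¹ := by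
  rcases subsingleton_or_nontrivial E with h | h
  · exact Or.inl h
  · right
    have : ‖((ContinuousLinearEquiv.refl ℝ E).symm : E →L[ℝ] E)‖₊ = 1 := by
      ext
      exact ContinuousLinearMap.norm_id
    rw [this, inv_one]
    exact NNReal.half_lt_self one_ne_zero

/-- Inversion of a family of maps close to the identity, with uniform bounds for the inverses. -/
theorem UnifCk.exists_inverse [CompleteSpace E] {k : ℕ} {W : P → Set E} {g : P → E → E}
    (hg : UnifCk 0 (k + 1) W g) (hc : ∀ p, Convex ℝ (W p))
    (hb : ∀ p, ∀ x ∈ W p, ‖_root_.fderiv ℝ (g p) x‖ ≤ 1 / 2)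
    (hs : ∀ p, ∀ y ∈ W p, ∃ x ∈ W p, x + g p x = y) :
    ∃ K : P → E → E, UnifCk 1 (k + 1) W K ∧
      (∀ p, ∀ y ∈ W p, K p y ∈ W p ∧ K p y + g p (K p y) = y) ∧
      (∀ p, ∀ x ∈ W p, K p (x + g p x) = x) := by
  have hW := hg.isOpen
  have hdg : ∀ p, ∀ x ∈ W p, DifferentiableAt ℝ (g p) x := fun p x hx =>
    hg.differentiableAt (by omega) hx
  let e := fun p => (approximatesLinearOn_id_add (hc p) (hdg p)
    (hb p)).toOpenPartialHomeomorph _ _ subsingleton_or_half_lt (hW p)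
  have htgt : ∀ p, ∀ y ∈ W p, y ∈ (e p).target := by
    intro p y hy
    obtain ⟨x, hx, hxy⟩ := hs p y hy
    exact ⟨x, hx, hxy⟩
  have hmem : ∀ p, ∀ y ∈ W p, (e p).symm y ∈ W p := fun p y hy =>
    (e p).map_target (htgt p y hy)
  have hright : ∀ p, ∀ y ∈ W p, (e p).symm y + g p ((e p).symm y) = y := fun p y hy =>
    (e p).right_inv (htgt p y hy)
  have hleft : ∀ p, ∀ x ∈ W p, (e p).symm (x + g p x) = x := fun p x hx =>
    (e p).left_inv hx
  refine ⟨fun p => (e p).symm, ?_, fun p y hy => ⟨hmem p y hy, hright p y hy⟩, hleft⟩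
  have hequiv : ∀ p, ∀ x ∈ W p, ∃ A : E ≃L[ℝ] E,
      (A : E →L[ℝ] E) = 1 + _root_.fderiv ℝ (g p) x := by
    intro p x hx
    have hlt : ‖-_root_.fderiv ℝ (g p) x‖ < 1 := by
      rw [norm_neg]
      exact (hb p x hx).trans_lt (by norm_num)
    refine ⟨ContinuousLinearEquiv.unitsEquiv ℝ E (Units.oneSub _ hlt), ?_⟩
    ext v
    simp
  have hderiv : ∀ p, ∀ x ∈ W p, HasFDerivAt (e p) (1 + _root_.fderiv ℝ (g p) x) x :=
    fun p x hx => (hasFDerivAt_id x).add (hdg p x hx).hasFDerivAt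
  have hcd : ∀ p, ContDiffOn ℝ (k + 1 : ℕ) ((e p).symm) (W p) := by
    intro p y hy
    obtain ⟨A, hA⟩ := hequiv p _ (hmem p y hy)
    refine ((e p).contDiffAt_symm (f₀' := A) (htgt p y hy) ?_ ?_).contDiffWithinAt
    · rw [hA]; exact hderiv p _ (hmem p y hy)
    · exact contDiffAt_id.add ((hg.contDiffOn p).contDiffAt ((hW p).mem_nhds (hmem p y hy)))
  have hinv : ∀ p, ∀ y ∈ W p,
      (1 + _root_.fderiv ℝ (g p) ((e p).symm y)) * _root_.fderiv ℝ (e p).symm y = 1 ∧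
      _root_.fderiv ℝ (e p).symm y * (1 + _root_.fderiv ℝ (g p) ((e p).symm y)) = 1 := by
    intro p y hy
    obtain ⟨A, hA⟩ := hequiv p _ (hmem p y hy)
    have h1 : HasFDerivAt (e p).symm (A.symm : E →L[ℝ] E) y := by
      refine (e p).hasFDerivAt_symm (htgt p y hy) ?_
      rw [hA]; exact hderiv p _ (hmem p y hy)
    rw [h1.fderiv, ← hA]
    constructor <;> ext v <;> simp
  -- From A = 1 - D A with ‖D‖ ≤ 1/2 one gets ‖A‖ ≤ 1 + ‖A‖/2.
  have hnorm : ∀ p, ∀ y ∈ W p, ‖_root_.fderiv ℝ (e p).symm y‖ ≤ 2 := by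
    intro p y hy
    set D := _root_.fderiv ℝ (g p) ((e p).symm y)
    set A := _root_.fderiv ℝ (e p).symm y
    have h1 : A = 1 - D * A := by
      have := (hinv p y hy).1
      rw [add_mul, one_mul] at this
      exact eq_sub_of_add_eq this
    have h2 : ‖A‖ ≤ 1 + 1 / 2 * ‖A‖ := by
      calc ‖A‖ = ‖1 - D * A‖ := by rw [← h1]
        _ ≤ ‖(1 : E →L[ℝ] E)‖ + ‖D * A‖ := norm_sub_le _ _
        _ ≤ 1 + 1 / 2 * ‖A‖ := by
          gcongr
          · exact ContinuousLinearMap.norm_id_le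
          · exact (norm_mul_le _ _).trans (by gcongr; exact hb p _ (hmem p y hy))
    linarith
  -- Bootstrap: bounds of order j on K give bounds of order j on 1 + Dg ∘ K, hence on its inverse
  -- DK, hence of order j + 1 on K. The case j = 0 asks for no bound, since only positive orders
  -- count.
  have main : ∀ j ≤ k + 1, UnifCk 1 j W (fun p => ((e p).symm : E → E)) := by
    intro j
    induction j with
    | zero =>
      exact fun _ => ⟨hW, fun p => (hcd p).of_le (by simp), 0, fun p x hx m _ _ => by omega⟩
    | succ j ih =>
      intro hj
      have h1 := (hg.fderiv.mono_order le_rfl (show j ≤ k by omega)).comp (ih (by omega)) hmem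
      have h2 := (const (k := j) (c := fun _ : P => (1 : E →L[ℝ] E)) (C := 1) hW
        (fun _ => ContinuousLinearMap.norm_id_le)).add h1
      refine of_fderiv_one hW (fun p x hx => ((hcd p).contDiffAt ((hW p).mem_nhds
        hx)).differentiableAt (by norm_cast)) ?_
      refine of_mul_eq_one h2 (fun p => ?_) hnorm (fun p y hy => (hinv p y hy).1)
        fun p y hy => (hinv p y hy).2
      exact (hcd p).fderiv_of_isOpen (hW p) (by exact_mod_cast hj)
  exact main _ le_rfl

end NearIdentity

/-! ### Partial derivatives against norms of total derivatives. -/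

section PartialDerivatives

variable {ι E : Type} [NormedAddCommGroup E] [NormedSpace ℝ E]

/-- Multilinear expansion in the basis has (card ι)^m terms, each with coordinates bounded by the
norms of the arguments. -/
theorem norm_le_of_basis [Fintype ι] (b : Module.Basis ι ℝ E) (hb : ∀ x i, |b.repr x i| ≤ ‖x‖) {m : ℕ}
    (M : E [×m]→L[ℝ] ℝ) {C : ℝ} (hC : 0 ≤ C) (hM : ∀ σ : Fin m → ι, |M (fun i => b (σ i))| ≤ C) :
    ‖M‖ ≤ (Fintype.card ι : ℝ) ^ m * C := by
  classical
  refine M.opNorm_le_bound (by positivity) fun v => ?_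
  have h1 : M v = ∑ σ : Fin m → ι, (∏ i, b.repr (v i) (σ i)) • M (fun i => b (σ i)) := by
    have e : v = fun i => ∑ j, b.repr (v i) j • b j := by
      ext i; rw [b.sum_repr]
    conv_lhs => rw [e]
    rw [← ContinuousMultilinearMap.coe_coe, MultilinearMap.map_sum]
    exact Finset.sum_congr rfl fun σ _ => MultilinearMap.map_smul_univ _ _ _
  rw [h1]
  calc ‖∑ σ : Fin m → ι, (∏ i, b.repr (v i) (σ i)) • M (fun i => b (σ i))‖
      ≤ ∑ σ : Fin m → ι, (∏ i, ‖v i‖) * C := by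
        refine norm_sum_le_of_le _ fun σ _ => ?_
        rw [norm_smul, norm_prod]
        gcongr with i
        · exact hb _ _
        · exact hM σ
    _ = (Fintype.card ι : ℝ) ^ m * C * ∏ i, ‖v i‖ := by
        simp [Finset.card_univ]; ring

theorem InCkBall.abs_le {b : Module.Basis ι ℝ E} {k : ℕ} {D : Set E} {C : ℝ} (hC : 0 ≤ C)
    {F : E → ℝ} (h : InCkBall b k D C F) {m : ℕ} (hm : m ≤ k) (σ : Fin m → ι) {x : E}
    (hx : x ∈ D) : |iteratedFDerivWithin ℝ m F D x (fun i => b (σ i))| ≤ C := by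
  have h1 : ‖iteratedFDerivWithin ℝ m F D x (fun i => b (σ i))‖ₑ ≤ ENNReal.ofReal C := by
    refine le_trans ?_ h.2
    unfold ckNorm
    refine le_iSup_of_le m (le_iSup_of_le hm (le_iSup_of_le σ (le_iSup_of_le x
      (le_iSup_of_le hx le_rfl))))
  rw [← ofReal_norm, ENNReal.ofReal_le_ofReal_iff hC] at h1
  exact h1

theorem InCkBall.norm_iteratedFDeriv_le [Fintype ι] {b : Module.Basis ι ℝ E}
    (hb : ∀ x i, |b.repr x i| ≤ ‖x‖) {k : ℕ} {D V : Set E} {F : E → ℝ} (h : InCkBall b k D 1 F)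
    (hι : 1 ≤ Fintype.card ι) (hV : IsOpen V) (hVD : V ⊆ D) {m : ℕ} (hm : m ≤ k) {x : E}
    (hx : x ∈ V) : ‖iteratedFDeriv ℝ m F x‖ ≤ (Fintype.card ι : ℝ) ^ k := by
  have e : iteratedFDeriv ℝ m F x = iteratedFDerivWithin ℝ m F D x := by
    rw [← iteratedFDerivWithin_univ]
    refine iteratedFDerivWithin_congr_set ?_ m
    filter_upwards [hV.mem_nhds hx] with y hy
    exact propext (iff_of_true (mem_univ y) (hVD hy))
  rw [e]
  refine (norm_le_of_basis b hb _ zero_le_one fun σ => h.abs_le zero_le_one hm σ (hVD hx)).trans ?_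
  rw [mul_one]
  exact pow_le_pow_right₀ (by exact_mod_cast hι) hm

/-- Basis vectors have norm at most 1, so no constant is lost in this direction. The bounds are
available for Q on an open set, while F only has to agree with Q on D. -/
theorem inCkBall_of_bound {b : Module.Basis ι ℝ E} (hb : ∀ i, ‖b i‖ ≤ 1) {k : ℕ} {D V : Set E}
    {F Q : E → ℝ} {C : ℝ} (hD : UniqueDiffOn ℝ D) (hV : IsOpen V) (hDV : D ⊆ V)
    (hQ : ContDiffOn ℝ k Q V)
    (hC : ∀ x ∈ V, ∀ m ≤ k, ‖iteratedFDeriv ℝ m Q x‖ ≤ C) (hF : ∀ x ∈ D, F x = Q x) :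
    InCkBall b k D C F := by
  refine ⟨(hQ.mono hDV).congr hF, ?_⟩
  unfold ckNorm
  refine iSup_le fun m => iSup_le fun hm => iSup_le fun σ => iSup_le fun x => iSup_le fun hx => ?_
  rw [iteratedFDerivWithin_congr hF hx, iteratedFDerivWithin_eq_iteratedFDeriv hD
    ((hQ.contDiffAt (hV.mem_nhds (hDV hx))).of_le (by exact_mod_cast hm)) hx,
    ← ofReal_norm]
  refine ENNReal.ofReal_le_ofReal ?_
  refine (ContinuousMultilinearMap.le_opNorm _ _).trans ?_
  refine le_trans ?_ (hC x (hDV hx) m hm)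
  exact mul_le_of_le_one_right (norm_nonneg _)
    (Finset.prod_le_one (fun _ _ => norm_nonneg _) fun i _ => hb _)

theorem abs_actionBasis_repr_le (x : Action) (i : Fin 2) : |actionBasis.repr x i| ≤ ‖x‖ := by
  simpa [actionBasis] using norm_le_pi_norm x i

theorem abs_coverBasis_repr_le (x : Cover) (i : Fin 2 ⊕ Fin 2) : |coverBasis.repr x i| ≤ ‖x‖ := by
  rcases i with i | i
  · simpa [coverBasis] using (norm_le_pi_norm x.1 i).trans (norm_fst_le x)
  · simpa [coverBasis] using (norm_le_pi_norm x.2 i).trans (norm_snd_le x)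

theorem norm_coverBasis_le (i : Fin 2 ⊕ Fin 2) : ‖coverBasis i‖ ≤ 1 := by
  rcases i with i | i <;> simp [coverBasis, Prod.norm_def, Pi.norm_single]

end PartialDerivatives


/-! ### Averages and primitives in the second angle. -/

section Averaging

theorem hasDerivAt_segment {E G : Type} [NormedAddCommGroup E]
    [NormedSpace ℝ E] [NormedAddCommGroup G] [NormedSpace ℝ G] {F : E → G}
    {x v : E} {s : ℝ} (hF : DifferentiableAt ℝ F (x + s • v)) :
    HasDerivAt (fun t : ℝ => F (x + t • v)) (fderiv ℝ F (x + s • v) v) s := by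
  have h3 : HasDerivAt (fun t : ℝ => x + t • v) v s := by
    simpa using ((hasDerivAt_id s).smul_const v).const_add x
  exact hF.hasFDerivAt.comp_hasDerivAt s h3

/-- The unit vector of the angle `i`. -/
def angleVec (i : Fin 2) : Cover := (Pi.single i 1, 0)

/-- The unit vector of the action `i`. -/
def actionVec (i : Fin 2) : Cover := (0, Pi.single i 1)

/-- The part `ℝ² × A` of the universal cover. -/
def cyl (A : Set Action) : Set Cover := (univ : Set (Fin 2 → ℝ)) ×ˢ A

/-- Integration over the second angle, against the affine weight `α s + β`. -/
noncomputable def angleInt (α β : ℝ) (F : Cover → ℝ) (x : Cover) : ℝ :=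
  ∫ s in (0 : ℝ)..1, (α * s + β) * F (x + s • angleVec 1)

/-- Periodicity in the angle `i`. -/
def AnglePeriodic (i : Fin 2) (F : Cover → ℝ) : Prop := ∀ x, F (x + angleVec i) = F x

theorem mem_cyl {A : Set Action} {x : Cover} : x ∈ cyl A ↔ x.2 ∈ A := by simp [cyl]

theorem isOpen_cyl {A : Set Action} (hA : IsOpen A) : IsOpen (cyl A) := isOpen_univ.prod hA

theorem add_smul_angleVec_mem {A : Set Action} {x : Cover} (hx : x ∈ cyl A) (s : ℝ) (i : Fin 2) :
    x + s • angleVec i ∈ cyl A := by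
  rw [mem_cyl] at *
  simpa [angleVec] using hx

theorem AnglePeriodic.fderiv {i : Fin 2} {F : Cover → ℝ} (h : AnglePeriodic i F) (v : Cover) :
    AnglePeriodic i (fun x => fderiv ℝ F x v) := by
  intro x
  have e : (fun y => F (y + angleVec i)) = F := funext h
  change _root_.fderiv ℝ F (x + angleVec i) v = _
  rw [← fderiv_comp_add_right, e]

theorem AnglePeriodic.angleInt {i : Fin 2} {F : Cover → ℝ} (h : AnglePeriodic i F) (α β : ℝ) :
    AnglePeriodic i (angleInt α β F) := by
  intro x
  simp only [NearIntegrable.angleInt]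
  refine intervalIntegral.integral_congr fun s _ => ?_
  have : x + angleVec i + s • angleVec 1 = x + s • angleVec 1 + angleVec i := by abel
  simp only [this, h _]

variable {P : Type} {U : P → Set Action} {F : P → Cover → ℝ} {k : ℕ}

theorem unifCk_angleInt_integrand (α β : ℝ) (hF : UnifCk 0 k (fun p => cyl (U p)) F) :
    UnifCk 0 k (fun p => cyl (U p) ×ˢ Ioo (-1 : ℝ) 2)
      (fun p (y : Cover × ℝ) => (α * y.2 + β) * F p (y.1 + y.2 • angleVec 1)) := by
  have hO : ∀ p, IsOpen (cyl (U p) ×ˢ Ioo (-1 : ℝ) 2) := fun p => (hF.isOpen p).prod isOpen_Ioo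
  have h1 : UnifCk 0 k (fun p => cyl (U p) ×ˢ Ioo (-1 : ℝ) 2)
      (fun p (y : Cover × ℝ) => α * y.2) := by
    refine UnifCk.of_one (C := |α| * 2) ((UnifCk.clm_one hO
      (fun _ => α • ContinuousLinearMap.snd ℝ Cover ℝ) (fun _ => le_rfl))) fun p y hy => ?_
    have h2 : |y.2| ≤ 2 := abs_le.2 ⟨by linarith [hy.2.1], hy.2.2.le⟩
    simp
    gcongr
  have h2 := h1.add (UnifCk.const (k := k) (c := fun _ : P => β) hO (fun _ => le_rfl))
  have h3 := (UnifCk.clm_one (k := k) hO (fun _ => ContinuousLinearMap.fst ℝ Cover ℝ +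
      (ContinuousLinearMap.snd ℝ Cover ℝ).smulRight (angleVec 1)) (fun _ => le_rfl))
  exact h2.mul (hF.comp h3 fun p y hy => by
    simpa using add_smul_angleVec_mem hy.1 _ _)

theorem unifCk_angleInt (α β : ℝ) (hF : UnifCk 0 k (fun p => cyl (U p)) F) :
    UnifCk 0 k (fun p => cyl (U p)) (fun p => angleInt α β (F p)) :=
  (unifCk_angleInt_integrand α β hF).integral hF.isOpen

theorem continuousOn_line {G : Type} [NormedAddCommGroup G] {A : Set Action} {F : Cover → G}
    (hF : ContinuousOn F (cyl A)) {x : Cover} (hx : x ∈ cyl A) (i : Fin 2) :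
    Continuous (fun s : ℝ => F (x + s • angleVec i)) := by
  rw [← continuousOn_univ]
  exact hF.comp (by fun_prop) fun s _ => add_smul_angleVec_mem hx s i

/-- The weight depends on s alone and the shift of the argument is a translation, so differentiation
commutes with the operator. -/
theorem fderiv_angleInt (α β : ℝ) (hF : UnifCk 0 (k + 1) (fun p => cyl (U p)) F) (p : P)
    {x : Cover} (hx : x ∈ cyl (U p)) (v : Cover) :
    fderiv ℝ (angleInt α β (F p)) x v = angleInt α β (fun y => fderiv ℝ (F p) y v) x := by
  have h1 := hasFDerivAt_integral_of_unifCk (unifCk_angleInt_integrand α β hF) hF.isOpen p hx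
  have e : ∀ s : ℝ, s ∈ Ioo (-1 : ℝ) 2 → (fderiv ℝ (fun y : Cover × ℝ =>
      (α * y.2 + β) * F p (y.1 + y.2 • angleVec 1)) (x, s)).comp
      (ContinuousLinearMap.inl ℝ Cover ℝ) =
      (α * s + β) • fderiv ℝ (F p) (x + s • angleVec 1) := by
    intro s hs
    have h0 : HasFDerivAt (fun y : Cover => (y, s)) (ContinuousLinearMap.inl ℝ Cover ℝ) x :=
      hasFDerivAt_prodMk_left x s
    have h2 := ((unifCk_angleInt_integrand α β hF).differentiableAt (by omega) (p := p)
      (x := (x, s)) ⟨hx, hs⟩).hasFDerivAt.comp x h0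
    have h3 : HasFDerivAt (fun y : Cover => y + s • angleVec 1) (ContinuousLinearMap.id ℝ Cover) x :=
      (hasFDerivAt_id x).add_const _
    have h4 := ((hF.differentiableAt (by omega) (p := p)
      (add_smul_angleVec_mem hx s 1)).hasFDerivAt.comp x h3).const_smul (α * s + β)
    have h5 := h2.unique (h4.congr_of_eventuallyEq (Filter.Eventually.of_forall fun y => by
      simp))
    rw [h5]
    rfl
  have hc : Continuous (fun s : ℝ => fderiv ℝ (F p) (x + s • angleVec 1)) :=
    continuousOn_line (hF.fderiv.contDiffOn p).continuousOn hx 1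
  change (fderiv ℝ (fun x => ∫ s in (0 : ℝ)..1, (α * s + β) * F p (x + s • angleVec 1)) x) v = _
  rw [h1.fderiv, intervalIntegral.integral_congr (g := fun s =>
    (α * s + β) • fderiv ℝ (F p) (x + s • angleVec 1))]
  · rw [ContinuousLinearMap.intervalIntegral_apply]
    · simp [angleInt]
    · exact Continuous.intervalIntegrable (by fun_prop) _ _
  · intro s hs
    rw [uIcc_of_le zero_le_one] at hs
    exact e s ⟨by linarith [hs.1], by linarith [hs.2]⟩

/-- The operator `angleInt 1 (-1/2)` inverts `∂/∂θ₂` up to averages. -/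
theorem fderiv_anglePrim (hF : UnifCk 0 (k + 1) (fun p => cyl (U p)) F) (p : P)
    (hper : AnglePeriodic 1 (F p)) {x : Cover} (hx : x ∈ cyl (U p)) :
    fderiv ℝ (angleInt 1 (-1 / 2) (F p)) x (angleVec 1) = F p x - angleInt 0 1 (F p) x := by
  rw [fderiv_angleInt _ _ hF p hx]
  have hc : Continuous (fun s : ℝ => fderiv ℝ (F p) (x + s • angleVec 1)) :=
    continuousOn_line (hF.fderiv.contDiffOn p).continuousOn hx 1
  -- Integration by parts against s - 1/2: by periodicity the boundary terms add up to F(x), and the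
  -- remaining integral is the average.
  have h1 := intervalIntegral.integral_mul_deriv_eq_deriv_mul (a := 0) (b := 1)
    (u := fun s : ℝ => 1 * s + -1 / 2) (u' := fun _ => 1)
    (v := fun s => F p (x + s • angleVec 1))
    (v' := fun s => fderiv ℝ (F p) (x + s • angleVec 1) (angleVec 1))
    (fun s _ => by simpa using (hasDerivAt_id s).add_const (-1 / 2 : ℝ))
    (fun s _ => hasDerivAt_segment (hF.differentiableAt (by omega) (add_smul_angleVec_mem hx s 1)))
    intervalIntegrable_const
    (Continuous.intervalIntegrable (by fun_prop) _ _)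
  simp only [angleInt]
  rw [h1]
  simp [hper x]
  ring

/-- The weight s - 1/2 selects the primitive of mean zero. Integrating S by parts against s gives
S(x) - ∫ s (F - F̄), and this integral is S(x) itself; no double integral is needed. -/
theorem angleAvg_anglePrim (hF : UnifCk 0 (k + 1) (fun p => cyl (U p)) F) (p : P)
    (hper : AnglePeriodic 1 (F p)) {x : Cover} (hx : x ∈ cyl (U p)) :
    angleInt 0 1 (angleInt 1 (-1 / 2) (F p)) x = 0 := by
  set S := angleInt 1 (-1 / 2) (F p) with hS
  have hSu := unifCk_angleInt 1 (-1 / 2) hF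
  have hA : ∀ t : ℝ, angleInt 0 1 (F p) (x + t • angleVec 1) = angleInt 0 1 (F p) x := by
    intro t
    have hφ : Function.Periodic (fun s : ℝ => F p (x + s • angleVec 1)) 1 := fun s => by
      simp only [add_smul, one_smul, ← add_assoc]
      exact hper _
    have h1 := hφ.intervalIntegral_add_eq t 0
    have h2 := intervalIntegral.integral_comp_add_left (a := 0) (b := 1)
      (fun s : ℝ => F p (x + s • angleVec 1)) t
    simp only [angleInt, zero_mul, zero_add, one_mul, add_zero] at *
    rw [← h1, ← h2]
    refine intervalIntegral.integral_congr fun s _ => ?_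
    simp only [add_smul, add_assoc]
  have hcF : Continuous (fun s : ℝ => F p (x + s • angleVec 1)) :=
    continuousOn_line (hF.contDiffOn p).continuousOn hx 1
  have h1 := intervalIntegral.integral_mul_deriv_eq_deriv_mul (a := 0) (b := 1)
    (u := fun s : ℝ => s) (u' := fun _ => 1)
    (v := fun s => S (x + s • angleVec 1))
    (v' := fun s => F p (x + s • angleVec 1) - angleInt 0 1 (F p) x)
    (fun s _ => hasDerivAt_id s)
    (fun s _ => by
      have hm := add_smul_angleVec_mem hx s 1
      have := hasDerivAt_segment (hSu.differentiableAt (by omega) (p := p) hm)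
      rwa [fderiv_anglePrim hF p hper hm, hA] at this)
    intervalIntegrable_const
    (Continuous.intervalIntegrable (hcF.sub continuous_const) _ _)
  have e1 : S (x + (1 : ℝ) • angleVec 1) = S x := by
    rw [one_smul]; exact hper.angleInt _ _ x
  have e2 : S x = (∫ s in (0 : ℝ)..1, s * F p (x + s • angleVec 1))
      - 1 / 2 * angleInt 0 1 (F p) x := by
    simp only [hS, angleInt]
    rw [← intervalIntegral.integral_const_mul, ← intervalIntegral.integral_sub]
    · refine intervalIntegral.integral_congr fun s _ => ?_
      ring
    · exact (continuous_id.mul hcF).intervalIntegrable _ _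
    · exact Continuous.intervalIntegrable
        (continuous_const.mul (Continuous.mul (by fun_prop) hcF)) _ _
  have e3 : (∫ s in (0 : ℝ)..1, s * (F p (x + s • angleVec 1) - angleInt 0 1 (F p) x)) =
      (∫ s in (0 : ℝ)..1, s * F p (x + s • angleVec 1)) - 1 / 2 * angleInt 0 1 (F p) x := by
    simp only [mul_sub]
    rw [intervalIntegral.integral_sub]
    · simp
    · exact (continuous_id.mul hcF).intervalIntegrable _ _
    · exact Continuous.intervalIntegrable (by fun_prop) _ _
  rw [e3, e1, ← e2] at h1
  simp only [angleInt, zero_mul, zero_add, one_mul, sub_zero] at h1 ⊢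
  linarith

end Averaging


/-! ### The truncated Neumann series and its error. -/

section CohomologicalEquation

/-- The frequency `∂h / ∂I_i`, for `h` differentiable near the point considered. -/
noncomputable def partialAction (h : Action → ℝ) (i : Fin 2) (I : Action) : ℝ :=
  fderiv ℝ h I (Pi.single i 1)

/-- The terms of the Neumann series that solves the cohomological equation. -/
noncomputable def neumannTerm (F : Cover → ℝ) : ℕ → Cover → ℝ
  | 0 => F
  | j + 1 => angleInt 1 (-1 / 2) (fun x => fderiv ℝ (neumannTerm F j) x (angleVec 0))

/-- The slope `ω₁ / ω₂` of the frequency vector. -/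
noncomputable def slope (h : Action → ℝ) (I : Action) : ℝ :=
  partialAction h 0 I * (partialAction h 1 I)⁻¹

/-- The generating function: an approximate solution of the cohomological equation. -/
noncomputable def generator (l : ℕ) (h : Action → ℝ) (F : Cover → ℝ) (x : Cover) : ℝ :=
  -∑ j ∈ Finset.range (l + 1),
    ((-slope h x.2) ^ j * (partialAction h 1 x.2)⁻¹) * angleInt 1 (-1 / 2) (neumannTerm F j) x

variable {F : Cover → ℝ}

theorem AnglePeriodic.neumannTerm {i : Fin 2} (h : AnglePeriodic i F) (j : ℕ) :
    AnglePeriodic i (neumannTerm F j) := by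
  induction j with
  | zero => exact h
  | succ j ih => exact (ih.fderiv _).angleInt _ _

theorem AnglePeriodic.generator {i : Fin 2} (hF : AnglePeriodic i F) (l : ℕ) (h : Action → ℝ) :
    AnglePeriodic i (generator l h F) := by
  intro x
  have e : (x + angleVec i).2 = x.2 := by simp [angleVec]
  simp only [NearIntegrable.generator, e]
  congr 1
  refine Finset.sum_congr rfl fun j _ => ?_
  rw [(hF.neumannTerm j).angleInt]

variable {P : Type} {U : P → Set Action} {k l : ℕ} {h : P → Action → ℝ} {F : P → Cover → ℝ} {c : ℝ}

theorem unifCk_fderiv_apply {E : Type} [NormedAddCommGroup E] [NormedSpace ℝ E] {U : P → Set E}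
    {F : P → E → ℝ} (hF : UnifCk 0 (k + 1) U F) (v : E) :
    UnifCk 0 k U (fun p x => fderiv ℝ (F p) x v) :=
  hF.fderiv.clm_comp (ContinuousLinearMap.apply ℝ ℝ v)

theorem unifCk_comp_snd {G : Type} [NormedAddCommGroup G] [NormedSpace ℝ G] {a : P → Action → G}
    (ha : UnifCk 0 k U a) : UnifCk 0 k (fun p => cyl (U p)) (fun p x => a p x.2) :=
  ha.comp (UnifCk.clm_one (fun p => isOpen_cyl (ha.isOpen p))
    (fun _ => ContinuousLinearMap.snd ℝ (Fin 2 → ℝ) Action) (fun _ => le_rfl))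
    fun _ _ hx => mem_cyl.1 hx

theorem unifCk_neumannTerm (j : ℕ) (hF : UnifCk 0 (k + j) (fun p => cyl (U p)) F) :
    UnifCk 0 k (fun p => cyl (U p)) (fun p => neumannTerm (F p) j) := by
  induction j generalizing k with
  | zero => exact hF
  | succ j ih =>
    have := ih (k := k + 1) (hF.mono_order le_rfl (by omega))
    exact unifCk_angleInt _ _ (unifCk_fderiv_apply this (angleVec 0))

theorem unifCk_inv_freq (hc : 0 < c) (hh : UnifCk 0 (k + 1) U h)
    (hω : ∀ p, ∀ I ∈ U p, c ≤ partialAction (h p) 1 I) :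
    UnifCk 0 k U (fun p I => (partialAction (h p) 1 I)⁻¹) :=
  (unifCk_fderiv_apply hh (Pi.single 1 1)).inv hc hω

theorem unifCk_slope (hc : 0 < c) (hh : UnifCk 0 (k + 1) U h)
    (hω : ∀ p, ∀ I ∈ U p, c ≤ partialAction (h p) 1 I) :
    UnifCk 0 k U (fun p => slope (h p)) :=
  (unifCk_fderiv_apply hh (Pi.single 0 1)).mul (unifCk_inv_freq hc hh hω)

theorem unifCk_generator (hc : 0 < c) (hh : UnifCk 0 (k + 1) U h)
    (hF : UnifCk 0 (k + l) (fun p => cyl (U p)) F)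
    (hω : ∀ p, ∀ I ∈ U p, c ≤ partialAction (h p) 1 I) :
    UnifCk 0 k (fun p => cyl (U p)) (fun p => generator l (h p) (F p)) := by
  refine (UnifCk.sum _ hF.isOpen fun j hj => ?_).neg
  have h1 := unifCk_comp_snd (((unifCk_slope hc hh hω).neg.pow j).mul (unifCk_inv_freq hc hh hω))
  have h2 := unifCk_neumannTerm j (hF.mono_order le_rfl
    (show k + j ≤ k + l by have := Finset.mem_range.1 hj; omega))
  exact h1.mul (unifCk_angleInt _ _ h2)

/-- The coefficients depend on the actions only, so they are constant along a line in an angle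
direction. -/
theorem fderiv_generator_angleVec (hF : UnifCk 0 (l + 1) (fun p => cyl (U p)) F)
    {p : P} {x : Cover} (hx : x ∈ cyl (U p)) (hd : DifferentiableAt ℝ (generator l (h p) (F p)) x)
    (i : Fin 2) :
    fderiv ℝ (generator l (h p) (F p)) x (angleVec i) = -∑ j ∈ Finset.range (l + 1),
      ((-slope (h p) x.2) ^ j * (partialAction (h p) 1 x.2)⁻¹) *
        fderiv ℝ (angleInt 1 (-1 / 2) (neumannTerm (F p) j)) x (angleVec i) := by
  have h1 : HasDerivAt (fun t : ℝ => generator l (h p) (F p) (x + t • angleVec i))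
      (fderiv ℝ (generator l (h p) (F p)) x (angleVec i)) 0 := by
    have := hasDerivAt_segment (F := generator l (h p) (F p)) (x := x) (v := angleVec i) (s := 0)
      (by simpa using hd)
    simpa using this
  refine h1.unique ?_
  have e : ∀ t : ℝ, (x + t • angleVec i).2 = x.2 := fun t => by simp [angleVec]
  simp only [generator, e]
  refine (HasDerivAt.fun_sum fun j hj => HasDerivAt.const_mul _ ?_).neg
  have h2 := unifCk_angleInt 1 (-1 / 2) (unifCk_neumannTerm (k := 1) j (hF.mono_order le_rfl
    (by have := Finset.mem_range.1 hj; omega)))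
  have := hasDerivAt_segment (F := angleInt 1 (-1 / 2) (neumannTerm (F p) j)) (x := x)
    (v := angleVec i) (s := 0) (by simpa using h2.differentiableAt le_rfl hx)
  simpa using this

/-- Write a = ω₁/ω₂ and N_j for the Neumann terms. The j-th summand contributes (-a)^(j+1) N_(j+1) -
(-a)^j N_j + (-a)^j avg N_j. The first two telescope, and only avg N_0 survives, since every later
N_j is a primitive of mean zero. -/
theorem cohomological_equation (hc : 0 < c) (hh : UnifCk 0 2 U h)
    (hF : UnifCk 0 (l + 2) (fun p => cyl (U p)) F)
    (hω : ∀ p, ∀ I ∈ U p, c ≤ partialAction (h p) 1 I) (hper : ∀ p, AnglePeriodic 1 (F p))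
    (p : P) {x : Cover} (hx : x ∈ cyl (U p)) :
    partialAction (h p) 0 x.2 * fderiv ℝ (generator l (h p) (F p)) x (angleVec 0) +
      partialAction (h p) 1 x.2 * fderiv ℝ (generator l (h p) (F p)) x (angleVec 1) + F p x =
    angleInt 0 1 (F p) x + (-slope (h p) x.2) ^ (l + 1) * neumannTerm (F p) (l + 1) x := by
  have hω0 : partialAction (h p) 1 x.2 ≠ 0 := (hc.trans_le (hω p _ (mem_cyl.1 hx))).ne'
  have hd := (unifCk_generator (l := l) hc hh (hF.mono_order le_rfl
    (show 1 + l ≤ l + 2 by omega)) hω).differentiableAt le_rfl hx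
  have hN : ∀ j ∈ Finset.range (l + 1), UnifCk 0 2 (fun p => cyl (U p))
      (fun p => neumannTerm (F p) j) := fun j hj => unifCk_neumannTerm j
    (hF.mono_order le_rfl (by have := Finset.mem_range.1 hj; omega))
  have h0 : ∀ j ∈ Finset.range (l + 1), fderiv ℝ (angleInt 1 (-1 / 2) (neumannTerm (F p) j)) x
      (angleVec 0) = neumannTerm (F p) (j + 1) x := fun j hj =>
    fderiv_angleInt _ _ (hN j hj) p hx _
  have h1 : ∀ j ∈ Finset.range (l + 1), fderiv ℝ (angleInt 1 (-1 / 2) (neumannTerm (F p) j)) x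
      (angleVec 1) = neumannTerm (F p) j x - angleInt 0 1 (neumannTerm (F p) j) x := fun j hj =>
    fderiv_anglePrim (hN j hj) p ((hper p).neumannTerm j) hx
  have h2 : ∀ j ∈ Finset.range l, angleInt 0 1 (neumannTerm (F p) (j + 1)) x = 0 := fun j hj =>
    angleAvg_anglePrim (unifCk_fderiv_apply (hN j (Finset.mem_range.2
      (by have := Finset.mem_range.1 hj; omega))) (angleVec 0)) p
      (((hper p).neumannTerm j).fderiv _) hx
  rw [fderiv_generator_angleVec (hF.mono_order le_rfl (by omega)) hx hd,
    fderiv_generator_angleVec (hF.mono_order le_rfl (by omega)) hx hd]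
  set a := slope (h p) x.2 with ha
  set w := partialAction (h p) 1 x.2
  have key : ∑ j ∈ Finset.range (l + 1), ((-a) ^ (j + 1) * neumannTerm (F p) (j + 1) x -
      (-a) ^ j * neumannTerm (F p) j x) =
      (-a) ^ (l + 1) * neumannTerm (F p) (l + 1) x - F p x := by
    rw [Finset.sum_range_sub (fun j => (-a) ^ j * neumannTerm (F p) j x)]
    simp [neumannTerm]
  have key2 : ∑ j ∈ Finset.range (l + 1), (-a) ^ j * angleInt 0 1 (neumannTerm (F p) j) x =
      angleInt 0 1 (F p) x := by
    rw [Finset.sum_range_succ', Finset.sum_eq_zero]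
    · simp [neumannTerm]
    · intro j hj; rw [h2 j hj, mul_zero]
  have key3 : ∀ j ∈ Finset.range (l + 1),
      -(partialAction (h p) 0 x.2 * ((-a) ^ j * w⁻¹ *
        fderiv ℝ (angleInt 1 (-1 / 2) (neumannTerm (F p) j)) x (angleVec 0))) +
      -(w * ((-a) ^ j * w⁻¹ *
        fderiv ℝ (angleInt 1 (-1 / 2) (neumannTerm (F p) j)) x (angleVec 1))) =
      ((-a) ^ (j + 1) * neumannTerm (F p) (j + 1) x - (-a) ^ j * neumannTerm (F p) j x) +
        (-a) ^ j * angleInt 0 1 (neumannTerm (F p) j) x := by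
    intro j hj
    have haw : partialAction (h p) 0 x.2 = a * w := by
      rw [ha, slope, mul_assoc, inv_mul_cancel₀ hω0, mul_one]
    rw [h0 j hj, h1 j hj, haw, pow_succ]
    field_simp
    ring
  rw [mul_neg, mul_neg, Finset.mul_sum, Finset.mul_sum, ← Finset.sum_neg_distrib,
    ← Finset.sum_neg_distrib, ← Finset.sum_add_distrib, Finset.sum_congr rfl key3,
    Finset.sum_add_distrib, key, key2]
  ring

end CohomologicalEquation


/-! ### Taylor remainders in integral form. -/

section Taylor

variable {P E : Type} [NormedAddCommGroup E] [NormedSpace ℝ E] {k : ℕ} {W W' : P → Set E}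
  {F : P → E → ℝ} {b : P → E → E} {ε : P → ℝ} {C : ℝ}

/-- The first order remainder `(F (x + ε b(x)) - F x) / ε`. -/
noncomputable def taylorOne (F : E → ℝ) (ε : ℝ) (b : E → E) (x : E) : ℝ :=
  ∫ s in (0 : ℝ)..1, fderiv ℝ F (x + s • ε • b x) (b x)

/-- The second order remainder `(F (x + ε b(x)) - F x - ε DF(x) b(x)) / ε ^ 2`. -/
noncomputable def taylorTwo (F : E → ℝ) (ε : ℝ) (b : E → E) (x : E) : ℝ :=
  ∫ s in (0 : ℝ)..1, (1 - s) * fderiv ℝ (fderiv ℝ F) (x + s • ε • b x) (b x) (b x)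

theorem unifCk_fst {G : Type} [NormedAddCommGroup G] [NormedSpace ℝ G] {b : P → E → G}
    (hb : UnifCk 0 k W' b) :
    UnifCk 0 k (fun p => W' p ×ˢ Ioo (-1 : ℝ) 2) (fun p (y : E × ℝ) => b p y.1) :=
  hb.comp (UnifCk.clm_one (fun p => (hb.isOpen p).prod isOpen_Ioo)
    (fun _ => ContinuousLinearMap.fst ℝ E ℝ) (fun _ => le_rfl)) fun _ _ hy => hy.1

theorem unifCk_snd (hW : ∀ p, IsOpen (W' p)) :
    UnifCk 0 k (fun p => W' p ×ˢ Ioo (-1 : ℝ) 2) (fun _ (y : E × ℝ) => y.2) := by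
  refine UnifCk.of_one (C := 2) (UnifCk.clm_one (fun p => (hW p).prod isOpen_Ioo)
    (fun _ => ContinuousLinearMap.snd ℝ E ℝ) (fun _ => le_rfl)) fun p y hy => ?_
  exact abs_le.2 ⟨by linarith [hy.2.1], hy.2.2.le⟩

/-- The inner map contains x itself, possibly unbounded, so only its derivatives of positive order
are bounded; this suffices for composition. -/
theorem unifCk_displaced {G : Type} [NormedAddCommGroup G] [NormedSpace ℝ G] {F : P → E → G}
    (hF : UnifCk 0 k W F) (hb : UnifCk 0 k W' b)
    (hε : ∀ p, |ε p| ≤ C)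
    (hm : ∀ p, ∀ x ∈ W' p, ∀ s ∈ Ioo (-1 : ℝ) 2, x + s • ε p • b p x ∈ W p) :
    UnifCk 0 k (fun p => W' p ×ˢ Ioo (-1 : ℝ) 2)
      (fun p (y : E × ℝ) => F p (y.1 + y.2 • ε p • b p y.1)) := by
  have hO : ∀ p, IsOpen (W' p ×ˢ Ioo (-1 : ℝ) 2) := fun p => (hb.isOpen p).prod isOpen_Ioo
  have h1 := (unifCk_snd hb.isOpen).smul
    ((UnifCk.const (c := ε) (C := C) (k := k) hO hε).smul (unifCk_fst hb))
  have h2 := (UnifCk.clm_one (k := k) hO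
    (fun _ => ContinuousLinearMap.fst ℝ E ℝ) (fun _ => le_rfl)).add
    (h1.mono_order (Nat.zero_le 1) le_rfl)
  exact hF.comp h2 fun p y hy => hm p y.1 hy.1 y.2 hy.2

theorem unifCk_taylorOne (hF : UnifCk 0 (k + 1) W F) (hb : UnifCk 0 k W' b)
    (hε : ∀ p, |ε p| ≤ C)
    (hm : ∀ p, ∀ x ∈ W' p, ∀ s ∈ Ioo (-1 : ℝ) 2, x + s • ε p • b p x ∈ W p) :
    UnifCk 0 k W' (fun p => taylorOne (F p) (ε p) (b p)) :=
  (UnifCk.bilin (ContinuousLinearMap.id ℝ (E →L[ℝ] ℝ)) (unifCk_displaced hF.fderiv hb hε hm)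
    (unifCk_fst hb)).integral hb.isOpen

theorem unifCk_taylorTwo (hF : UnifCk 0 (k + 2) W F) (hb : UnifCk 0 k W' b)
    (hε : ∀ p, |ε p| ≤ C)
    (hm : ∀ p, ∀ x ∈ W' p, ∀ s ∈ Ioo (-1 : ℝ) 2, x + s • ε p • b p x ∈ W p) :
    UnifCk 0 k W' (fun p => taylorTwo (F p) (ε p) (b p)) := by
  have h1 := UnifCk.bilin (ContinuousLinearMap.id ℝ (E →L[ℝ] E →L[ℝ] ℝ))
    (unifCk_displaced (hF.fderiv (k := k + 1)).fderiv hb hε hm) (unifCk_fst hb)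
  have h2 := UnifCk.bilin (ContinuousLinearMap.id ℝ (E →L[ℝ] ℝ)) h1 (unifCk_fst hb)
  have h3 := (UnifCk.const (k := k) (c := fun _ : P => (1 : ℝ)) (C := 1)
    (fun p => (hb.isOpen p).prod isOpen_Ioo) (by simp)).sub (unifCk_snd (k := k) hb.isOpen)
  exact (h3.mul h2).integral hb.isOpen

theorem eq_taylorOne {F : E → ℝ} {W : Set E} {b : E → E} {x : E} {ε : ℝ} (hW : IsOpen W)
    (hF : ContDiffOn ℝ 1 F W) (hm : ∀ s ∈ Icc (0 : ℝ) 1, x + s • ε • b x ∈ W) :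
    F (x + ε • b x) = F x + ε * taylorOne F ε b x := by
  have hc : ContinuousOn (fun s : ℝ => fderiv ℝ F (x + s • ε • b x)) (uIcc (0 : ℝ) 1) := by
    rw [uIcc_of_le zero_le_one]
    exact (hF.continuousOn_fderiv_of_isOpen hW le_rfl).comp (by fun_prop) fun s hs => hm s hs
  have h1 := intervalIntegral.integral_eq_sub_of_hasDerivAt (a := 0) (b := 1)
    (f := fun s : ℝ => F (x + s • ε • b x))
    (f' := fun s => fderiv ℝ F (x + s • ε • b x) (ε • b x))
    (fun s hs => by
      rw [uIcc_of_le zero_le_one] at hs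
      exact hasDerivAt_segment ((hF.contDiffAt (hW.mem_nhds (hm s hs))).differentiableAt
        one_ne_zero))
    (hc.clm_apply continuousOn_const).intervalIntegrable
  simp only [map_smul, smul_eq_mul, intervalIntegral.integral_const_mul] at h1
  simp only [one_smul, zero_smul, add_zero] at h1
  rw [taylorOne, h1]; ring

theorem eq_taylorTwo {F : E → ℝ} {W : Set E} {b : E → E} {x : E} {ε : ℝ} (hW : IsOpen W)
    (hF : ContDiffOn ℝ 2 F W) (hm : ∀ s ∈ Icc (0 : ℝ) 1, x + s • ε • b x ∈ W) :
    F (x + ε • b x) = F x + ε * fderiv ℝ F x (b x) + ε ^ 2 * taylorTwo F ε b x := by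
  have hF' : ContDiffOn ℝ 1 (fderiv ℝ F) W := hF.fderiv_of_isOpen hW (by norm_num)
  have hc : ContinuousOn (fun s : ℝ => fderiv ℝ (fderiv ℝ F) (x + s • ε • b x))
      (uIcc (0 : ℝ) 1) := by
    rw [uIcc_of_le zero_le_one]
    exact (hF'.continuousOn_fderiv_of_isOpen hW le_rfl).comp (by fun_prop) fun s hs => hm s hs
  -- Along the segment, with g(s) the value of F, the function g + (1 - s) g' has derivative (1 - s)
  -- g''.
  have h1 := intervalIntegral.integral_eq_sub_of_hasDerivAt (a := 0) (b := 1)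
    (f := fun s : ℝ => F (x + s • ε • b x) + (1 - s) * fderiv ℝ F (x + s • ε • b x) (ε • b x))
    (f' := fun s => (1 - s) * fderiv ℝ (fderiv ℝ F) (x + s • ε • b x) (ε • b x) (ε • b x))
    (fun s hs => by
      rw [uIcc_of_le zero_le_one] at hs
      have hn := hW.mem_nhds (hm s hs)
      have d1 := hasDerivAt_segment ((hF.contDiffAt hn).differentiableAt two_ne_zero)
      have d2 := hasDerivAt_segment ((hF'.contDiffAt hn).differentiableAt one_ne_zero)
      have d3 := d2.clm_apply (hasDerivAt_const s (ε • b x))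
      have d4 := d1.add (((hasDerivAt_id s).const_sub 1).mul d3)
      refine d4.congr_deriv ?_
      simp)
    ((continuousOn_const.sub continuousOn_id).mul ((hc.clm_apply continuousOn_const).clm_apply
      continuousOn_const)).intervalIntegrable
  have e : ∀ s : ℝ, (1 - s) * fderiv ℝ (fderiv ℝ F) (x + s • ε • b x) (ε • b x) (ε • b x) =
      ε ^ 2 * ((1 - s) * fderiv ℝ (fderiv ℝ F) (x + s • ε • b x) (b x) (b x)) := fun s => by
    simp; ring
  simp only [e, intervalIntegral.integral_const_mul] at h1
  rw [taylorTwo, h1]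
  simp

end Taylor

/-! ### Symplectic algebra of a generating function. -/

section GeneratingFunction

/-- The displacement `(∂χ/∂I, 0)` of the angles. -/
noncomputable def angleShift : (Cover →L[ℝ] ℝ) →L[ℝ] Cover :=
  (ContinuousLinearMap.inl ℝ (Fin 2 → ℝ) Action).comp
    (ContinuousLinearMap.pi fun i => ContinuousLinearMap.apply ℝ ℝ (actionVec i))

/-- The displacement `(0, ∂χ/∂θ)` of the actions. -/
noncomputable def actionShift : (Cover →L[ℝ] ℝ) →L[ℝ] Cover :=
  (ContinuousLinearMap.inr ℝ (Fin 2 → ℝ) Action).comp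
    (ContinuousLinearMap.pi fun i => ContinuousLinearMap.apply ℝ ℝ (angleVec i))

theorem angleShift_apply (φ : Cover →L[ℝ] ℝ) : angleShift φ = (fun i => φ (actionVec i), 0) := rfl

theorem actionShift_apply (φ : Cover →L[ℝ] ℝ) : actionShift φ = (0, fun i => φ (angleVec i)) := rfl

theorem norm_angleVec (i : Fin 2) : ‖angleVec i‖ = 1 := by
  simp [angleVec, Prod.norm_def, Pi.norm_single]

theorem norm_actionVec (i : Fin 2) : ‖actionVec i‖ = 1 := by
  simp [actionVec, Prod.norm_def, Pi.norm_single]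

theorem norm_angleShift_apply_le (φ : Cover →L[ℝ] ℝ) : ‖(angleShift φ).1‖ ≤ ‖φ‖ := by
  refine (pi_norm_le_iff_of_nonneg (norm_nonneg _)).2 fun i => ?_
  simpa [norm_actionVec, angleShift_apply] using φ.le_opNorm (actionVec i)

theorem norm_actionShift_apply_le (φ : Cover →L[ℝ] ℝ) : ‖(actionShift φ).2‖ ≤ ‖φ‖ := by
  refine (pi_norm_le_iff_of_nonneg (norm_nonneg _)).2 fun i => ?_
  simpa [norm_angleVec, actionShift_apply] using φ.le_opNorm (angleVec i)

theorem norm_angleShift_le : ‖angleShift‖ ≤ 1 := by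
  refine ContinuousLinearMap.opNorm_le_bound _ zero_le_one fun φ => ?_
  rw [one_mul, Prod.norm_def]
  refine max_le (norm_angleShift_apply_le φ) ?_
  simp [angleShift_apply]

theorem norm_actionShift_le : ‖actionShift‖ ≤ 1 := by
  refine ContinuousLinearMap.opNorm_le_bound _ zero_le_one fun φ => ?_
  rw [one_mul, Prod.norm_def]
  refine max_le ?_ (norm_actionShift_apply_le φ)
  simp [actionShift_apply]

theorem cover_eq_sum (v : Cover) :
    v = v.1 0 • angleVec 0 + v.1 1 • angleVec 1 + v.2 0 • actionVec 0 + v.2 1 • actionVec 1 := by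
  ext i <;> fin_cases i <;> simp [angleVec, actionVec]

/-- The two maps defined by a generating function pull back the symplectic form to the same form. -/
theorem symplecticForm_actionShift (ε : ℝ) {B : Cover →L[ℝ] Cover →L[ℝ] ℝ}
    (hB : ∀ u v, B u v = B v u) (u v : Cover) :
    symplecticForm (u + ε • actionShift (B u)) (v + ε • actionShift (B v)) =
      symplecticForm (u + ε • angleShift (B u)) (v + ε • angleShift (B v)) := by
  have h1 : B u v = v.1 0 * B u (angleVec 0) + v.1 1 * B u (angleVec 1) +
      v.2 0 * B u (actionVec 0) + v.2 1 * B u (actionVec 1) := by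
    conv_lhs => rw [cover_eq_sum v]
    simp
  have h2 : B v u = u.1 0 * B v (angleVec 0) + u.1 1 * B v (angleVec 1) +
      u.2 0 * B v (actionVec 0) + u.2 1 * B v (actionVec 1) := by
    conv_lhs => rw [cover_eq_sum u]
    simp
  have h3 := hB u v
  -- There are no ε² terms, as two pure angle vectors, or two pure action vectors, pair to zero. The
  -- terms in ε differ by a multiple of B u v - B v u.
  simp only [symplecticForm, Fin.sum_univ_two, angleShift_apply, actionShift_apply, Prod.fst_add,
    Prod.snd_add, Prod.smul_fst, Prod.smul_snd, Pi.add_apply, Pi.smul_apply, smul_eq_mul,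
    Pi.zero_apply, smul_zero, add_zero]
  rw [h1, h2] at h3
  linear_combination (-ε) * h3

end GeneratingFunction


/-! ### The normal form on the universal cover. -/

section NormalForm

/-- A Hamiltonian pair `(h, F)` on the universal cover with bounded norms, whose second frequency is
bounded below by `c` on the convex open set `U`. -/
structure CoverDatum (l : ℕ) (M c : ℝ) where
  h : Action → ℝ
  F : Cover → ℝ
  U : Set Action
  isOpen : IsOpen U
  convex : Convex ℝ U
  contDiffOn_h : ContDiffOn ℝ (l + 3 : ℕ) h U
  h_le : ∀ x ∈ U, ∀ m ≤ l + 3, ‖iteratedFDeriv ℝ m h x‖ ≤ M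
  contDiffOn_F : ContDiffOn ℝ (2 * l + 5 : ℕ) F (cyl U)
  F_le : ∀ x ∈ cyl U, ∀ m ≤ 2 * l + 5, ‖iteratedFDeriv ℝ m F x‖ ≤ M
  periodic : ∀ i, AnglePeriodic i F
  le_freq : ∀ I ∈ U, c ≤ partialAction h 1 I

/-- The generating function of a datum. -/
noncomputable def CoverDatum.χ {l : ℕ} {M c : ℝ} (d : CoverDatum l M c) : Cover → ℝ :=
  generator l d.h d.F

/-- A datum whose first frequency is of order `ε`, with a smaller open set `V ⊆ U` of actions. -/
structure ResonantDatum (l : ℕ) (M c m A ε₀ : ℝ) extends CoverDatum l M c where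
  V : Set Action
  ε : ℝ
  isOpen_V : IsOpen V
  ε_pos : 0 < ε
  ε_le : ε ≤ ε₀
  room : ∀ I ∈ V, ∀ J, ‖J - I‖ ≤ 2 * ε * m → J ∈ U
  freq_small : ∀ I ∈ U, |partialAction h 0 I| ≤ A * ε

variable {l : ℕ} {M c m A ε₀ : ℝ}

theorem unifCk_h : UnifCk 0 (l + 3) (fun d : CoverDatum l M c => d.U) (fun d => d.h) :=
  ⟨fun d => d.isOpen, fun d => d.contDiffOn_h, M, fun d x hx m _ hm => d.h_le x hx m hm⟩

theorem unifCk_F : UnifCk 0 (2 * l + 5) (fun d : CoverDatum l M c => cyl d.U) (fun d => d.F) :=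
  ⟨fun d => isOpen_cyl d.isOpen, fun d => d.contDiffOn_F, M, fun d x hx m _ hm => d.F_le x hx m hm⟩

theorem unifCk_χ (hc : 0 < c) :
    UnifCk 0 (l + 2) (fun d : CoverDatum l M c => cyl d.U) (fun d => d.χ) :=
  unifCk_generator hc unifCk_h (unifCk_F.mono_order le_rfl (by omega)) fun d => d.le_freq

/-- A bound for the first two derivatives of the generating function. -/
theorem exists_χ_bound (l : ℕ) (M : ℝ) (hc : 0 < c) : ∃ m, 0 < m ∧ ∀ d : CoverDatum l M c,
    ∀ x ∈ cyl d.U, ‖fderiv ℝ d.χ x‖ ≤ m ∧ ‖fderiv ℝ (fderiv ℝ d.χ) x‖ ≤ m := by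
  obtain ⟨m₁, h₁, h1⟩ := (unifCk_χ (l := l) (M := M) hc).fderiv.norm_le
  obtain ⟨m₂, h₂, h2⟩ := ((unifCk_χ (l := l) (M := M) hc).fderiv (k := l + 1)).fderiv.norm_le
  exact ⟨max m₁ m₂, lt_max_of_lt_left h₁, fun d x hx =>
    ⟨(h1 d x hx).trans (le_max_left _ _), (h2 d x hx).trans (le_max_right _ _)⟩⟩

/-- As g leaves the actions alone, the equation is solved in one slice of fixed action. There the
perturbed identity is defined on all of ℝ², hence onto, and no part of U is lost. -/
theorem exists_add_eq_of_snd_eq_zero {U : Set Action} {g : Cover → Cover} (hU : Convex ℝ U)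
    (hd : ∀ x ∈ cyl U, DifferentiableAt ℝ g x) (hb : ∀ x ∈ cyl U, ‖fderiv ℝ g x‖ ≤ 1 / 2)
    (h0 : ∀ x, (g x).2 = 0) {y : Cover} (hy : y ∈ cyl U) : ∃ x ∈ cyl U, x + g x = y := by
  have happ : ApproximatesLinearOn (fun θ : Fin 2 → ℝ => θ + (g (θ, y.2)).1)
      (ContinuousLinearEquiv.refl ℝ (Fin 2 → ℝ) : (Fin 2 → ℝ) →L[ℝ] (Fin 2 → ℝ)) univ (1 / 2) := by
    intro a _ b _
    have h1 := (convex_univ.prod hU).norm_image_sub_le_of_norm_fderiv_le (𝕜 := ℝ) hd hb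
      (x := (b, y.2)) (y := (a, y.2)) (mem_cyl.2 (mem_cyl.1 hy)) (mem_cyl.2 (mem_cyl.1 hy))
    have e : a + (g (a, y.2)).1 - (b + (g (b, y.2)).1) -
        (ContinuousLinearEquiv.refl ℝ (Fin 2 → ℝ) : (Fin 2 → ℝ) →L[ℝ] (Fin 2 → ℝ)) (a - b) =
        (g (a, y.2) - g (b, y.2)).1 := by
      simp; abel
    simp only [e]
    refine (norm_fst_le _).trans (h1.trans ?_)
    simp [Prod.norm_def]
  obtain ⟨θ, hθ⟩ := happ.surjective subsingleton_or_half_lt y.1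
  refine ⟨(θ, y.2), mem_cyl.2 (mem_cyl.1 hy), Prod.ext ?_ ?_⟩
  · simpa using hθ
  · simp [h0]

theorem fderiv_periodic {i : Fin 2} {F : Cover → ℝ} (h : AnglePeriodic i F) (x : Cover) :
    fderiv ℝ F (x + angleVec i) = fderiv ℝ F x :=
  ContinuousLinearMap.ext fun v => h.fderiv v x

/-- The normal form on the universal cover. -/
theorem normal_form_on_cover (hc : 0 < c) (hm0 : 0 < m)
    (hm : ∀ d : CoverDatum l M c, ∀ x ∈ cyl d.U,
      ‖fderiv ℝ d.χ x‖ ≤ m ∧ ‖fderiv ℝ (fderiv ℝ d.χ) x‖ ≤ m) (hε₀ : ε₀ * m ≤ 1 / 2) :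
    ∃ C : ℝ, 0 < C ∧ ∀ d : ResonantDatum l M c m A ε₀, ∃ (Ψ : Cover → Cover) (Q : Cover → ℝ),
      ContDiffOn ℝ (l + 1 : ℕ) Ψ (cyl d.U) ∧
      (∀ x ∈ cyl d.U, ∀ u v, symplecticForm (fderiv ℝ Ψ x u) (fderiv ℝ Ψ x v) =
        symplecticForm u v) ∧
      (∀ x ∈ cyl d.U, ‖Ψ x - x‖ ≤ d.ε * m) ∧
      (∀ x ∈ cyl d.U, ∀ i, Ψ (x + angleVec i) = Ψ x + angleVec i) ∧
      InjOn Ψ (cyl d.U) ∧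
      ContDiffOn ℝ l Q (cyl d.V) ∧
      (∀ x ∈ cyl d.V, ∀ j ≤ l, ‖iteratedFDeriv ℝ j Q x‖ ≤ C) ∧
      (∀ x ∈ cyl d.V, d.h (Ψ x).2 + d.ε * d.F (Ψ x) =
        d.h x.2 + d.ε * angleInt 0 1 d.F x + d.ε ^ 2 * Q x) := by
  let P := ResonantDatum l M c m A ε₀
  let π : P → CoverDatum l M c := fun d => d.toCoverDatum
  have hχ : UnifCk 0 (l + 2) (fun d : P => cyl d.U) (fun d => d.χ) := (unifCk_χ hc).reindex π
  have hh : UnifCk 0 (l + 3) (fun d : P => d.U) (fun d => d.h) := unifCk_h.reindex π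
  have hF : UnifCk 0 (2 * l + 5) (fun d : P => cyl d.U) (fun d => d.F) := unifCk_F.reindex π
  have hW : ∀ d : P, IsOpen (cyl d.U) := fun d => isOpen_cyl d.isOpen
  have hWc : ∀ d : P, Convex ℝ (cyl d.U) := fun d => convex_univ.prod d.convex
  have hV : ∀ d : P, IsOpen (cyl d.V) := fun d => isOpen_cyl d.isOpen_V
  have hVU : ∀ d : P, cyl d.V ⊆ cyl d.U := fun d x hx => mem_cyl.2
    (d.room _ (mem_cyl.1 hx) _ (by
      have := d.ε_pos
      rw [sub_self, norm_zero]; positivity))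
  have hεabs : ∀ d : P, |d.ε| ≤ ε₀ := fun d => by rw [abs_of_pos d.ε_pos]; exact d.ε_le
  have hεm : ∀ d : P, d.ε * m ≤ 1 / 2 := fun d =>
    (mul_le_mul_of_nonneg_right d.ε_le hm0.le).trans hε₀
  let b : P → Cover → Cover := fun d x => angleShift (fderiv ℝ d.χ x)
  let a : P → Cover → Cover := fun d x => actionShift (fderiv ℝ d.χ x)
  have hb : UnifCk 0 (l + 1) (fun d : P => cyl d.U) b := hχ.fderiv.clm_comp _
  have ha : UnifCk 0 (l + 1) (fun d : P => cyl d.U) a := hχ.fderiv.clm_comp _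
  have hdχ : ∀ d : P, ∀ x ∈ cyl d.U, HasFDerivAt (fderiv ℝ d.χ) (fderiv ℝ (fderiv ℝ d.χ) x) x :=
    fun d x hx => (hχ.fderiv.differentiableAt (by omega) hx).hasFDerivAt
  have hdb : ∀ d : P, ∀ x ∈ cyl d.U, HasFDerivAt (fun x => d.ε • b d x)
      (d.ε • angleShift.comp (fderiv ℝ (fderiv ℝ d.χ) x)) x := fun d x hx =>
    (angleShift.hasFDerivAt.comp x (hdχ d x hx)).const_smul d.ε
  have hda : ∀ d : P, ∀ x ∈ cyl d.U, HasFDerivAt (fun x => d.ε • a d x)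
      (d.ε • actionShift.comp (fderiv ℝ (fderiv ℝ d.χ) x)) x := fun d x hx =>
    (actionShift.hasFDerivAt.comp x (hdχ d x hx)).const_smul d.ε
  have hsmall : ∀ d : P, ∀ x ∈ cyl d.U, ∀ L : (Cover →L[ℝ] ℝ) →L[ℝ] Cover, ‖L‖ ≤ 1 →
      ‖d.ε • L.comp (fderiv ℝ (fderiv ℝ d.χ) x)‖ ≤ 1 / 2 := by
    intro d x hx L hL
    rw [norm_smul, Real.norm_of_nonneg d.ε_pos.le]
    refine le_trans ?_ (hεm d)
    refine mul_le_mul_of_nonneg_left ?_ d.ε_pos.le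
    refine (ContinuousLinearMap.opNorm_comp_le _ _).trans ?_
    exact (mul_le_of_le_one_left (norm_nonneg _) hL).trans (hm (π d) x hx).2
  have hεb : UnifCk 0 (l + 1) (fun d : P => cyl d.U) (fun d x => d.ε • b d x) :=
    (UnifCk.const (c := fun d : P => d.ε) hW hεabs).smul hb
  obtain ⟨K, hK, hKr, hKl⟩ := hεb.exists_inverse hWc
    (fun d x hx => by rw [(hdb d x hx).fderiv]; exact hsmall d x hx _ norm_angleShift_le)
    (fun d y hy => exists_add_eq_of_snd_eq_zero d.convex
      (fun x hx => (hdb d x hx).differentiableAt)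
      (fun x hx => by rw [(hdb d x hx).fderiv]; exact hsmall d x hx _ norm_angleShift_le)
      (fun x => by simp [b, angleShift_apply]) hy)
  have hK2 : ∀ d : P, ∀ y ∈ cyl d.U, (K d y).2 = y.2 := by
    intro d y hy
    conv_rhs => rw [← (hKr d y hy).2]
    simp [b, angleShift_apply]
  have hKV : ∀ d : P, MapsTo (K d) (cyl d.V) (cyl d.V) := fun d y hy => by
    rw [mem_cyl, hK2 d y (hVU d hy)]; exact mem_cyl.1 hy
  have hnb : ∀ d : P, ∀ x ∈ cyl d.U, ‖(b d x).1‖ ≤ m := fun d x hx =>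
    (norm_angleShift_apply_le _).trans (hm (π d) x hx).1
  have hna : ∀ d : P, ∀ x ∈ cyl d.U, ‖(a d x).2‖ ≤ m := fun d x hx =>
    (norm_actionShift_apply_le _).trans (hm (π d) x hx).1
  -- The parameter s reaches 2 in absolute value, which explains the factor 2 in `room`.
  have hma : ∀ d : P, ∀ x ∈ cyl d.V, ∀ s ∈ Ioo (-1 : ℝ) 2, x + s • d.ε • a d x ∈ cyl d.U := by
    intro d x hx s hs
    refine mem_cyl.2 (d.room x.2 (mem_cyl.1 hx) _ ?_)
    have hs2 : |s| ≤ 2 := abs_le.2 ⟨by linarith [hs.1], hs.2.le⟩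
    have := d.ε_pos
    simp only [Prod.snd_add, Prod.smul_snd, add_sub_cancel_left, norm_smul, Real.norm_eq_abs,
      abs_of_pos this]
    rw [mul_assoc]
    gcongr
    exact hna d x (hVU d hx)
  have hmb : ∀ d : P, ∀ x ∈ cyl d.V, ∀ s ∈ Ioo (-1 : ℝ) 2, x + s • d.ε • b d x ∈ cyl d.U := by
    intro d x hx s _
    have := mem_cyl.1 (hVU d hx)
    simpa [mem_cyl, b, angleShift_apply] using this
  have hper : ∀ d : P, ∀ i, AnglePeriodic i d.χ := fun d i => (d.periodic i).generator _ _
  let hc2 : P → Cover → ℝ := fun d x => d.h x.2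
  have hhc : UnifCk 0 (l + 3) (fun d : P => cyl d.U) hc2 := unifCk_comp_snd hh
  have ha' := ha.mono_set hV hVU
  have hb' := hb.mono_set hV hVU
  have r1 := unifCk_taylorTwo hhc ha' hεabs hma
  have r2 := unifCk_taylorOne (hF.mono_order le_rfl (show l + 1 + 1 ≤ 2 * l + 5 by omega))
    ha' hεabs hma
  have r3 := unifCk_taylorOne ((unifCk_angleInt 0 1 hF).mono_order le_rfl
    (show l + 1 + 1 ≤ 2 * l + 5 by omega)) hb' hεabs hmb
  have hsl : UnifCk 0 (l + 2) (fun d : P => d.U) (fun d => slope d.h) :=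
    unifCk_slope hc hh fun d => d.le_freq
  -- The slope is O(ε) with constant A/c; its power l + 1 compensates the division by ε in C^l.
  have r4 : UnifCk 0 l (fun d : P => cyl d.U) (fun d x => (-slope d.h x.2) ^ (l + 1) / d.ε) := by
    refine UnifCk.pow_succ_div (k := l + 2) (C := A * c⁻¹) (by omega) (unifCk_comp_snd hsl.neg)
      (fun d => d.ε_pos) fun d x hx => ?_
    have hx' := mem_cyl.1 hx
    have h1 := d.freq_small x.2 hx'
    have h2 := d.le_freq x.2 hx'
    have h3 : (partialAction d.h 1 x.2)⁻¹ ≤ c⁻¹ := inv_anti₀ hc h2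
    rw [abs_neg, slope, abs_mul, abs_of_pos (inv_pos.2 (hc.trans_le h2)), mul_right_comm]
    exact mul_le_mul h1 h3 (inv_pos.2 (hc.trans_le h2)).le ((abs_nonneg _).trans h1)
  have r5 : UnifCk 0 l (fun d : P => cyl d.U) (fun d => neumannTerm d.F (l + 1)) :=
    unifCk_neumannTerm (l + 1) (hF.mono_order le_rfl (by omega))
  have hQ := (((r4.mul r5).mono_set hV hVU).add ((r1.add r2).sub r3 |>.mono_order le_rfl
    (Nat.le_succ l))).comp ((hK.mono_set hV hVU).mono_order le_rfl (Nat.le_succ l)) hKV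
  obtain ⟨C, hC⟩ := hQ.bdd
  refine ⟨max C 1, by positivity, fun d => ⟨fun y => K d y + d.ε • a d (K d y), _, ?_, ?_, ?_, ?_,
    ?_, hQ.contDiffOn d, fun x hx j hj => (hC d x hx j (Nat.zero_le _) hj).trans (le_max_left _ _),
    ?_⟩⟩
  · exact (hK.contDiffOn d).add (((ha.contDiffOn d).comp (hK.contDiffOn d)
      fun y hy => (hKr d y hy).1).const_smul d.ε)
  · intro y hy u v
    have hx := (hKr d y hy).1
    have dK := (hK.differentiableAt (by omega) hy).hasFDerivAt
    have dΨ := dK.add ((hda d _ hx).comp y dK)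
    -- By definition of K, the map K + ε b ∘ K is the identity near y, so one side of the symplectic
    -- identity is the standard form.
    have dG := (dK.add ((hdb d _ hx).comp y dK)).congr_of_eventuallyEq (f₁ := id) (by
      filter_upwards [(hW d).mem_nhds hy] with z hz
      exact (hKr d z hz).2.symm)
    have eG := dG.unique (hasFDerivAt_id y)
    have eΨ : fderiv ℝ (fun y => K d y + d.ε • a d (K d y)) y = _ := dΨ.fderiv
    have hsymm : IsSymmSndFDerivAt ℝ d.χ (K d y) :=
      ((hχ.contDiffOn d).contDiffAt ((hW d).mem_nhds hx)).isSymmSndFDerivAt (by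
        simp)
    have key := symplecticForm_actionShift d.ε (B := fderiv ℝ (fderiv ℝ d.χ) (K d y)) hsymm
      (fderiv ℝ (K d) y u) (fderiv ℝ (K d) y v)
    have eu := DFunLike.congr_fun eG u
    have ev := DFunLike.congr_fun eG v
    simp only [_root_.add_apply, ContinuousLinearMap.comp_apply,
      _root_.smul_apply, ContinuousLinearMap.id_apply] at eu ev
    rw [eu, ev] at key
    rw [eΨ]
    exact key
  · intro y hy
    have hx := (hKr d y hy).1
    have e : K d y + d.ε • a d (K d y) - y = d.ε • (a d (K d y) - b d (K d y)) := by
      have hy' : K d y + d.ε • b d (K d y) = y := (hKr d y hy).2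
      calc K d y + d.ε • a d (K d y) - y
          = K d y + d.ε • a d (K d y) - (K d y + d.ε • b d (K d y)) := by rw [hy']
        _ = d.ε • (a d (K d y) - b d (K d y)) := by rw [smul_sub]; abel
    rw [e, norm_smul, Real.norm_of_nonneg d.ε_pos.le]
    refine mul_le_mul_of_nonneg_left ?_ d.ε_pos.le
    rw [Prod.norm_def]
    refine max_le ?_ ?_
    · have e1 : (a d (K d y) - b d (K d y)).1 = -(b d (K d y)).1 := by
        simp [a, actionShift_apply]
      rw [e1, norm_neg]
      exact hnb d _ hx
    · have e1 : (a d (K d y) - b d (K d y)).2 = (a d (K d y)).2 := by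
        simp [b, angleShift_apply]
      rw [e1]
      exact hna d _ hx
  · intro y hy i
    have hx := (hKr d y hy).1
    have hx' : K d y + angleVec i ∈ cyl d.U := by simpa using add_smul_angleVec_mem hx 1 i
    -- The translate of K y solves the translated equation because Dχ is periodic; the left inverse
    -- property gives uniqueness.
    have e : K d (y + angleVec i) = K d y + angleVec i := by
      have h1 := hKl d _ hx'
      have h2 : K d y + angleVec i + d.ε • b d (K d y + angleVec i) = y + angleVec i := by
        simp only [b]
        rw [fderiv_periodic (hper d i), add_right_comm]
        exact congrArg (· + angleVec i) (hKr d y hy).2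
      rwa [h2] at h1
    simp only [a, e]
    rw [fderiv_periodic (hper d i), add_right_comm]
  -- Ψ is x ↦ x + ε a(x), itself a small perturbation of the identity, composed with the injective
  -- map K.
  · have happ := approximatesLinearOn_id_add (g := fun x => d.ε • a d x) (hWc d)
      (fun x hx => (hda d x hx).differentiableAt)
      (fun x hx => by rw [(hda d x hx).fderiv]; exact hsmall d x hx _ norm_actionShift_le)
    intro y hy z hz hyz
    have := happ.injOn subsingleton_or_half_lt (hKr d y hy).1 (hKr d z hz).1 hyz
    rw [← (hKr d y hy).2, this, (hKr d z hz).2]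
  · intro y hy
    have hyU := hVU d hy
    have hxV := hKV d hy
    have hxU := hVU d hxV
    have hIcc : ∀ s ∈ Icc (0 : ℝ) 1, s ∈ Ioo (-1 : ℝ) 2 := fun s hs =>
      ⟨by linarith [hs.1], by linarith [hs.2]⟩
    have t1 := eq_taylorTwo (F := hc2 d) (b := a d) (ε := d.ε) (hW d)
      ((hhc.contDiffOn d).of_le (by norm_cast; omega)) fun s hs => hma d _ hxV s (hIcc s hs)
    have t2 := eq_taylorOne (F := d.F) (b := a d) (ε := d.ε) (hW d)
      ((hF.contDiffOn d).of_le (by norm_cast; omega)) fun s hs => hma d _ hxV s (hIcc s hs)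
    have t3 := eq_taylorOne (F := angleInt 0 1 d.F) (b := b d) (ε := d.ε) (hW d)
      (((unifCk_angleInt 0 1 hF).contDiffOn d).of_le (by norm_cast; omega))
      fun s hs => hmb d _ hxV s (hIcc s hs)
    have t4 : partialAction d.h 0 (K d y).2 * fderiv ℝ d.χ (K d y) (angleVec 0) +
        partialAction d.h 1 (K d y).2 * fderiv ℝ d.χ (K d y) (angleVec 1) + d.F (K d y) =
        angleInt 0 1 d.F (K d y) +
          (-slope d.h (K d y).2) ^ (l + 1) * neumannTerm d.F (l + 1) (K d y) :=
      cohomological_equation hc (hh.mono_order le_rfl (by omega))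
      (hF.mono_order le_rfl (show l + 2 ≤ 2 * l + 5 by omega)) (fun d : P => d.le_freq)
      (fun d => d.periodic 1) d hxU
    have t5 : fderiv ℝ (hc2 d) (K d y) (a d (K d y)) =
        partialAction d.h 0 (K d y).2 * fderiv ℝ d.χ (K d y) (angleVec 0) +
        partialAction d.h 1 (K d y).2 * fderiv ℝ d.χ (K d y) (angleVec 1) := by
      have h1 : HasFDerivAt (hc2 d) _ (K d y) := (hh.differentiableAt (by omega)
        (mem_cyl.1 hxU)).hasFDerivAt.comp (K d y) (hasFDerivAt_snd (p := K d y))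
      rw [h1.fderiv]
      have e : (a d (K d y)).2 = fderiv ℝ d.χ (K d y) (angleVec 0) • Pi.single 0 1 +
          fderiv ℝ d.χ (K d y) (angleVec 1) • Pi.single 1 1 := by
        ext i; fin_cases i <;> simp [a, actionShift_apply]
      simp only [ContinuousLinearMap.comp_apply, ContinuousLinearMap.coe_snd', e, map_add, map_smul,
        partialAction, smul_eq_mul]
      ring
    rw [(hKr d y hyU).2] at t3
    change hc2 d (K d y + d.ε • a d (K d y)) + d.ε * d.F (K d y + d.ε • a d (K d y)) = _
    rw [t1, t2, t3, t5]
    have hε := d.ε_pos.ne'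
    have e0 : hc2 d (K d y) = d.h y.2 := by simp only [hc2, hK2 d y hyU]
    rw [e0]
    have t6 : d.ε * ((-slope d.h (K d y).2) ^ (l + 1) / d.ε) = (-slope d.h (K d y).2) ^ (l + 1) :=
      mul_div_cancel₀ _ hε
    -- The ε² term collects the cohomological error over ε, the remainders of h and F, and minus the
    -- remainder from moving the average of F from K y to y.
    linear_combination d.ε * t4 - d.ε * neumannTerm d.F (l + 1) (K d y) * t6

end NormalForm


/-! ### From the universal cover to the torus. -/

section Descent

theorem isOpenQuotientMap_proj : IsOpenQuotientMap proj :=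
  (IsOpenQuotientMap.piMap (f := fun (_ : Fin 2) (t : ℝ) => (t : UnitAddCircle))
    fun _ => QuotientAddGroup.isOpenQuotientMap_mk).prodMap (IsOpenQuotientMap.id (X := Action))

theorem proj_add_int_smul (x : Cover) (i : Fin 2) (n : ℤ) :
    proj (x + (n : ℝ) • angleVec i) = proj x := by
  refine Prod.ext ?_ (by simp [proj, angleVec])
  funext j
  have h : ((n : ℝ) : UnitAddCircle) = 0 := (AddCircle.coe_eq_zero_iff 1).2 ⟨n, by simp⟩
  rcases eq_or_ne j i with rfl | hj
  · have e : (x + (n : ℝ) • angleVec j).1 j = x.1 j + n := by simp [angleVec]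
    change (((x + (n : ℝ) • angleVec j).1 j : ℝ) : UnitAddCircle) = (x.1 j : ℝ)
    rw [e, AddCircle.coe_add, h, add_zero]
  · simp [proj, angleVec, hj]

theorem proj_add_angleVec (x : Cover) (i : Fin 2) : proj (x + angleVec i) = proj x := by
  simpa using proj_add_int_smul x i 1

theorem exists_int_of_proj_eq {x y : Cover} (h : proj x = proj y) :
    ∃ n : Fin 2 → ℤ, y = x + (n 0 : ℝ) • angleVec 0 + (n 1 : ℝ) • angleVec 1 := by
  have h1 : ∀ i, ∃ n : ℤ, y.1 i = x.1 i + n := by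
    intro i
    have e : ((x.1 i : ℝ) : UnitAddCircle) = (y.1 i : ℝ) := congrFun (congrArg Prod.fst h) i
    have e2 : ((y.1 i - x.1 i : ℝ) : UnitAddCircle) = 0 := by
      rw [AddCircle.coe_sub, e, sub_self]
    obtain ⟨n, hn⟩ := (AddCircle.coe_eq_zero_iff 1).1 e2
    refine ⟨n, ?_⟩
    rw [zsmul_eq_mul, mul_one] at hn
    rw [hn]; ring
  choose n hn using h1
  refine ⟨n, Prod.ext ?_ ?_⟩
  · funext i
    fin_cases i <;> simp [angleVec, hn]
  · have : x.2 = y.2 := congrArg (fun z : Phase => z.2) h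
    simp [angleVec, this]

theorem equivariant_int {U : Set Action} {Ψ : Cover → Cover} {i : Fin 2}
    (hΨ : ∀ x ∈ cyl U, Ψ (x + angleVec i) = Ψ x + angleVec i) (n : ℤ) {x : Cover}
    (hx : x ∈ cyl U) : Ψ (x + (n : ℝ) • angleVec i) = Ψ x + (n : ℝ) • angleVec i := by
  induction n using Int.induction_on with
  | zero => simp
  | succ n ih =>
    have := hΨ _ (add_smul_angleVec_mem hx (n : ℝ) i)
    push_cast at ih ⊢
    rw [add_smul, one_smul, ← add_assoc, this, ih, add_assoc]
  | pred n ih =>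
    have := hΨ _ (add_smul_angleVec_mem hx (-(n : ℝ) - 1) i)
    push_cast at ih ⊢
    have e : x + (-(n : ℝ) - 1) • angleVec i + angleVec i = x + (-(n : ℝ)) • angleVec i := by
      rw [sub_smul, one_smul]; abel
    rw [e, ih] at this
    rw [← sub_eq_iff_eq_add] at this
    rw [← this, sub_smul, one_smul]; abel

variable {U : Set Action} {Ψ : Cover → Cover}

/-- The map of the phase space induced by an equivariant map of the universal cover. -/
noncomputable def descend (Ψ : Cover → Cover) (z : Phase) : Phase :=
  proj (Ψ (Function.surjInv isOpenQuotientMap_proj.surjective z))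

/-- The chosen preimage differs from x by an integer translation, which Ψ commutes with and `proj`
forgets. -/
theorem descend_proj (hΨ : ∀ x ∈ cyl U, ∀ i, Ψ (x + angleVec i) = Ψ x + angleVec i) {x : Cover}
    (hx : x ∈ cyl U) : descend Ψ (proj x) = proj (Ψ x) := by
  have h1 := Function.surjInv_eq isOpenQuotientMap_proj.surjective (proj x)
  obtain ⟨n, hn⟩ := exists_int_of_proj_eq h1.symm
  rw [descend, hn, equivariant_int (fun x hx => hΨ x hx 1) _ (add_smul_angleVec_mem hx _ 0),
    equivariant_int (fun x hx => hΨ x hx 0) _ hx,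
    proj_add_int_smul, proj_add_int_smul]

/-- If the images agree on the torus, Ψ y is an integer translate of Ψ x, that is, the image of a
translate of x; injectivity upstairs concludes. -/
theorem injOn_descend (hΨ : ∀ x ∈ cyl U, ∀ i, Ψ (x + angleVec i) = Ψ x + angleVec i)
    (hinj : InjOn Ψ (cyl U)) : InjOn (descend Ψ) ((univ : Set Torus) ×ˢ U) := by
  intro z hz w hw hzw
  obtain ⟨x, rfl⟩ := isOpenQuotientMap_proj.surjective z
  obtain ⟨y, rfl⟩ := isOpenQuotientMap_proj.surjective w
  have hx : x ∈ cyl U := ⟨mem_univ _, hz.2⟩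
  have hy : y ∈ cyl U := ⟨mem_univ _, hw.2⟩
  rw [descend_proj hΨ hx, descend_proj hΨ hy] at hzw
  obtain ⟨n, hn⟩ := exists_int_of_proj_eq hzw
  rw [← equivariant_int (fun x hx => hΨ x hx 0) _ hx,
    ← equivariant_int (fun x hx => hΨ x hx 1) _ (add_smul_angleVec_mem hx _ 0)] at hn
  rw [hinj hy (add_smul_angleVec_mem (add_smul_angleVec_mem hx _ 0) _ 1) hn]
  rw [proj_add_int_smul, proj_add_int_smul]

theorem continuousOn_descend (hΨ : ∀ x ∈ cyl U, ∀ i, Ψ (x + angleVec i) = Ψ x + angleVec i)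
    (hU : IsOpen U) (hc : ContinuousOn Ψ (cyl U)) :
    ContinuousOn (descend Ψ) ((univ : Set Torus) ×ˢ U) := by
  intro z hz
  obtain ⟨x, rfl⟩ := isOpenQuotientMap_proj.surjective z
  have hx : x ∈ cyl U := ⟨mem_univ _, hz.2⟩
  refine ContinuousAt.continuousWithinAt ?_
  rw [ContinuousAt, ← isOpenQuotientMap_proj.isOpenMap.map_nhds_eq
    isOpenQuotientMap_proj.continuous.continuousAt, Filter.tendsto_map'_iff, descend_proj hΨ hx]
  have hn := (isOpen_cyl hU).mem_nhds hx
  have h1 : ContinuousAt (fun y => proj (Ψ y)) x :=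
    isOpenQuotientMap_proj.continuous.continuousAt.comp (hc.continuousAt hn)
  refine h1.congr' ?_
  filter_upwards [hn] with y hy
  exact (descend_proj hΨ hy).symm

theorem average_proj (f : Phase → ℝ) (x : Cover) :
    average f ((proj x).1 0) (proj x).2 = angleInt 0 1 (f ∘ proj) x := by
  unfold average angleInt
  rw [← UnitAddCircle.intervalIntegral_preimage (x.1 1)]
  have h2 := intervalIntegral.integral_comp_add_left (a := 0) (b := 1)
    (fun s : ℝ => f (![(proj x).1 0, (s : UnitAddCircle)], (proj x).2)) (x.1 1)
  rw [add_zero] at h2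
  rw [← h2]
  refine intervalIntegral.integral_congr fun s _ => ?_
  have e : proj (x + s • angleVec 1) =
      (![(proj x).1 0, ((x.1 1 + s : ℝ) : UnitAddCircle)], (proj x).2) := by
    refine Prod.ext ?_ ?_
    · funext i; fin_cases i <;> simp [proj, angleVec]
    · simp [proj, angleVec]
  simp [e]

/-- A continuous injection of a compact space into a Hausdorff space is a closed embedding. -/
theorem isEmbedding_descend {A : Set Action}
    (hΨ : ∀ x ∈ cyl U, ∀ i, Ψ (x + angleVec i) = Ψ x + angleVec i)
    (hU : IsOpen U) (hc : ContinuousOn Ψ (cyl U)) (hinj : InjOn Ψ (cyl U)) (hA : IsCompact A)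
    (hAU : A ⊆ U) :
    Topology.IsEmbedding (((univ : Set Torus) ×ˢ A).domRestrict (descend Ψ)) := by
  have hsub : (univ : Set Torus) ×ˢ A ⊆ univ ×ˢ U := prod_mono subset_rfl hAU
  have : CompactSpace ((univ : Set Torus) ×ˢ A : Set Phase) :=
    isCompact_iff_compactSpace.1 (isCompact_univ.prod hA)
  refine (Continuous.isClosedEmbedding ?_ ?_).isEmbedding
  · exact ((continuousOn_descend hΨ hU hc).mono hsub).domRestrict
  · exact ((injOn_descend hΨ hinj).mono hsub).injective

end Descent


/-! ### Choice of domains and constants. -/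

section Assembly

theorem convex_segment (a b : ℝ) : Convex ℝ (segment a b) := by
  intro x hx y hy s t hs ht hst
  refine ⟨convex_Icc a b hx.1 hy.1 hs ht hst, ?_⟩
  simp [hx.2, hy.2]

theorem segment_nonempty {a b : ℝ} (hab : a ≤ b) : (segment a b).Nonempty :=
  ⟨![a, 0], ⟨le_rfl, hab⟩, rfl⟩

theorem InCkBall.mono_order {ι E : Type} [NormedAddCommGroup E] [NormedSpace ℝ E]
    {b : Module.Basis ι ℝ E} {k k' : ℕ} {D : Set E} {C : ℝ} {F : E → ℝ} (h : InCkBall b k D C F)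
    (hk : k' ≤ k) : InCkBall b k' D C F := by
  refine ⟨h.1.of_le (by exact_mod_cast hk), le_trans ?_ h.2⟩
  unfold ckNorm
  exact iSup_mono fun m => iSup_le fun hm => le_iSup_of_le (hm.trans hk) le_rfl

theorem InCkBall.mono_bound {ι E : Type} [NormedAddCommGroup E] [NormedSpace ℝ E]
    {b : Module.Basis ι ℝ E} {k : ℕ} {D : Set E} {C C' : ℝ} {F : E → ℝ} (h : InCkBall b k D C F)
    (hC : C ≤ C') : InCkBall b k D C' F :=
  ⟨h.1, h.2.trans (ENNReal.ofReal_le_ofReal hC)⟩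

/-- The normal form for a fixed order of differentiability, with explicit hypotheses. -/
theorem normal_form_fixed_order (l : ℕ) (ϖ : ℝ) (hϖ : 0 < ϖ) :
    ∃ κ₀ : ℝ, 0 < κ₀ ∧ ∀ κ, κ₀ ≤ κ → ∃ ε₀ C : ℝ, 0 < ε₀ ∧ 0 < C ∧
      ∀ (R : ℝ) (h : Action → ℝ) (f : Phase → ℝ) (a b : ℝ),
        ActionCkBall (l + 3) (ball R) 1 h → PhaseCkBall (2 * l + 5) (ball R) 1 f → a ≤ b →
        (∀ I₁ ∈ Icc a b, freq R h 0 ![I₁, 0] = 0) →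
        (∀ I₁ ∈ Icc a b, ϖ ≤ freq R h 1 ![I₁, 0]) →
      ∀ ε : ℝ, 0 < ε → ε ≤ ε₀ → segmentNhd a b (κ * ε) ⊆ ball R →
        ∃ (Φ : Phase → Phase) (Ψ : Cover → Cover) (f' : Phase → ℝ),
          IsSymplecticEmbedding (l + 1) (segmentNhd a b (κ * ε / 2)) Φ Ψ ∧
          MapsTo Φ (domain a b (κ * ε / 2)) (domain a b (κ * ε)) ∧
          (∀ z ∈ domain a b (κ * ε / 2), hamiltonian h ε f (Φ z) =
            h z.2 + ε * average f (z.1 0) z.2 + ε ^ 2 * f' z) ∧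
          (∀ x ∈ (univ : Set (Fin 2 → ℝ)) ×ˢ segmentNhd a b (κ * ε / 2),
            ‖Ψ x - x‖ ≤ κ * ε / 2) ∧
          PhaseCkBall l (segmentNhd a b (κ * ε / 2)) C f' := by
  -- Passing from partial to total derivatives costs 2^(l+3) for two actions and 4^(2l+5) for four
  -- coordinates.
  set M : ℝ := max (2 ^ (l + 3)) (4 ^ (2 * l + 5)) with hM
  have hM0 : 0 < M := lt_max_of_lt_left (by positivity)
  have hc : 0 < ϖ / 2 := by positivity
  obtain ⟨m, hm0, hm⟩ := exists_χ_bound l M hc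
  -- With κ ≥ 8m, an action shift of 2εm fits in the gap κε/4 between V and U, and the displacement
  -- εm is below κε/2.
  refine ⟨8 * m, by positivity, fun κ hκ => ?_⟩
  have hκ0 : 0 < κ := lt_of_lt_of_le (by positivity) hκ
  -- The first bound makes the perturbations of the identity 1/2-Lipschitz. The second keeps the
  -- variation Mκε of the frequencies below ϖ/2, so that ω₂ ≥ ϖ/2 on U.
  set ε₀ : ℝ := min (1 / (2 * m)) (ϖ / (2 * (M * κ))) with hε₀
  have hε₀m : ε₀ * m ≤ 1 / 2 := by
    have : ε₀ ≤ 1 / (2 * m) := min_le_left _ _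
    calc ε₀ * m ≤ 1 / (2 * m) * m := by gcongr
      _ = 1 / 2 := by field_simp
  obtain ⟨C, hC0, hC⟩ := normal_form_on_cover (A := M * κ) hc hm0 hm hε₀m
  refine ⟨ε₀, C, lt_min (by positivity) (by positivity), hC0, ?_⟩
  intro R h f a b hh hf hab hω0 hω1 ε hε hεle hsub
  have hκε : 0 < κ * ε := by positivity
  set U : Set Action := Metric.thickening (κ * ε) (segment a b) with hU
  set V : Set Action := Metric.thickening (3 / 4 * (κ * ε)) (segment a b) with hV
  set A : Set Action := segmentNhd a b (κ * ε / 2) with hA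
  have hUo : IsOpen U := Metric.isOpen_thickening
  have hUc : Convex ℝ U := (convex_segment a b).thickening _
  have hUR : U ⊆ ball R := (Metric.thickening_subset_cthickening _ _).trans hsub
  have hAV : A ⊆ V := Metric.cthickening_subset_thickening' (by positivity) (by linarith) _
  have hVU : V ⊆ U := Metric.thickening_mono (by linarith) _
  have hAU : A ⊆ U := hAV.trans hVU
  have hhC : ContDiffOn ℝ (l + 3 : ℕ) h U := hh.1.mono hUR
  have hh_le : ∀ x ∈ U, ∀ m ≤ l + 3, ‖iteratedFDeriv ℝ m h x‖ ≤ M := fun x hx m hm =>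
    (InCkBall.norm_iteratedFDeriv_le abs_actionBasis_repr_le hh (by simp) hUo hUR hm hx).trans
      (by simp [hM])
  have hseg : segment a b ⊆ U := Metric.self_subset_thickening hκε _
  have hfreq : ∀ i, ∀ I ∈ U, freq R h i I = partialAction h i I := fun i I hI => by
    rw [freq, partialAction, fderivWithin_of_mem_nhds
      (Filter.mem_of_superset (hUo.mem_nhds hI) hUR)]
  have hh1 : ContDiffOn ℝ (1 : ℕ) (fderiv ℝ h) U :=
    hhC.fderiv_of_isOpen hUo (by norm_cast; omega)
  have hclose : ∀ I ∈ U, ∃ I₁ ∈ Icc a b, ∀ i,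
      |partialAction h i I - freq R h i ![I₁, 0]| ≤ M * (κ * ε) := by
    intro I hI
    obtain ⟨J, hJ, hIJ⟩ := Metric.mem_thickening_iff.1 hI
    have eJ : J = ![J 0, 0] := by
      ext i; fin_cases i
      · rfl
      · exact hJ.2
    refine ⟨J 0, hJ.1, fun i => ?_⟩
    rw [← eJ, hfreq i J (hseg hJ)]
    have h1 := hUc.norm_image_sub_le_of_norm_fderiv_le (𝕜 := ℝ) (f := fderiv ℝ h) (C := M)
      (fun x hx => (hh1.contDiffAt (hUo.mem_nhds hx)).differentiableAt (by norm_num))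
      (fun x hx => by
        rw [← norm_iteratedFDeriv_one, norm_iteratedFDeriv_fderiv]
        exact hh_le x hx _ (by omega)) (hseg hJ) hI
    have h2 : partialAction h i I - partialAction h i J =
        (fderiv ℝ h I - fderiv ℝ h J) (Pi.single i 1) := by simp [partialAction]
    rw [h2, ← Real.norm_eq_abs]
    refine (ContinuousLinearMap.le_opNorm _ _).trans ?_
    rw [Pi.norm_single, norm_one, mul_one]
    refine h1.trans ?_
    rw [← dist_eq_norm]
    gcongr
  have hεM : M * (κ * ε) ≤ ϖ / 2 := by
    have : ε ≤ ϖ / (2 * (M * κ)) := hεle.trans (min_le_right _ _)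
    calc M * (κ * ε) = M * κ * ε := by ring
      _ ≤ M * κ * (ϖ / (2 * (M * κ))) := by gcongr
      _ = ϖ / 2 := by field_simp
  have hcylR : cyl U ⊆ univ ×ˢ ball R := prod_mono subset_rfl hUR
  let d : ResonantDatum l M (ϖ / 2) m (M * κ) ε₀ :=
    { h := h
      F := f ∘ proj
      U := U
      isOpen := hUo
      convex := hUc
      contDiffOn_h := hhC
      h_le := hh_le
      contDiffOn_F := hf.1.mono hcylR
      F_le := fun x hx m hm => (InCkBall.norm_iteratedFDeriv_le abs_coverBasis_repr_le hf (by simp)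
        (isOpen_cyl hUo) hcylR hm hx).trans (by norm_num [hM])
      periodic := fun i x => congrArg f (proj_add_angleVec x i)
      le_freq := fun I hI => by
        obtain ⟨I₁, hI₁, h1⟩ := hclose I hI
        have h2 := (abs_le.1 (h1 1)).1
        have h3 := hω1 I₁ hI₁
        linarith
      V := V
      ε := ε
      isOpen_V := Metric.isOpen_thickening
      ε_pos := hε
      ε_le := hεle
      room := fun I hI J hJ => by
        obtain ⟨I', hI', hd⟩ := Metric.mem_thickening_iff.1 hI
        refine Metric.mem_thickening_iff.2 ⟨I', hI', ?_⟩
        have h1 := dist_triangle J I I'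
        rw [← dist_eq_norm] at hJ
        have h2 : 8 * m * ε ≤ κ * ε := by gcongr
        linarith
      freq_small := fun I hI => by
        obtain ⟨I₁, hI₁, h1⟩ := hclose I hI
        have h2 := h1 0
        rw [hω0 I₁ hI₁, sub_zero] at h2
        linarith }
  obtain ⟨Ψ, Q, hΨC, hΨs, hΨd, hΨp, hΨi, hQC, hQb, hQ⟩ := hC d
  have hcylA : (univ : Set (Fin 2 → ℝ)) ×ˢ A ⊆ cyl U := prod_mono subset_rfl hAU
  have hcylAV : (univ : Set (Fin 2 → ℝ)) ×ˢ A ⊆ cyl V := prod_mono subset_rfl hAV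
  -- The neighbourhood has interior points even when the segment is a single point.
  have huniq : UniqueDiffOn ℝ ((univ : Set (Fin 2 → ℝ)) ×ˢ A) := by
    refine uniqueDiffOn_univ.prod (uniqueDiffOn_convex ((convex_segment a b).cthickening _) ?_)
    refine Set.Nonempty.mono (interior_maximal (Metric.thickening_subset_cthickening _ _)
      Metric.isOpen_thickening) ?_
    exact (segment_nonempty hab).mono (Metric.self_subset_thickening (by positivity) _)
  have hAc : IsCompact A := Metric.isCompact_of_isClosed_isBounded Metric.isClosed_cthickening
    (Metric.isBounded_closedBall.subset (hAU.trans hUR))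
  have hmle : ε * m ≤ κ * ε / 2 := by
    have h2 : 8 * m * ε ≤ κ * ε := by gcongr
    nlinarith
  have hlift : ∀ x ∈ cyl U, descend Ψ (proj x) = proj (Ψ x) := fun x hx => descend_proj hΨp hx
  have hε2 : ε ^ 2 ≠ 0 := by positivity
  -- With f' defined as the quotient, the identity for H ∘ Φ is automatic; the content is that f'
  -- lifts to Q and so is bounded in C^l.
  refine ⟨descend Ψ, Ψ, fun z => (hamiltonian h ε f (descend Ψ z) -
    (h z.2 + ε * average f (z.1 0) z.2)) / ε ^ 2, ⟨?_, ?_, ?_, ?_⟩, ?_, ?_, ?_, ?_⟩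
  · exact fun x hx => (hlift x (hcylA hx)).symm
  · exact hΨC.mono hcylA
  · intro x hx u v
    have hd : DifferentiableAt ℝ Ψ x := (hΨC.contDiffAt
      ((isOpen_cyl hUo).mem_nhds (hcylA hx))).differentiableAt (by norm_cast)
    rw [hd.fderivWithin (huniq x hx)]
    exact hΨs x (hcylA hx) u v
  · exact isEmbedding_descend hΨp hUo hΨC.continuousOn hΨi hAc hAU
  · intro z hz
    obtain ⟨x, rfl⟩ := isOpenQuotientMap_proj.surjective z
    have hx : x ∈ (univ : Set (Fin 2 → ℝ)) ×ˢ A := ⟨mem_univ _, hz.2⟩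
    rw [hlift x (hcylA hx)]
    refine ⟨mem_univ _, ?_⟩
    have h1 : dist (Ψ x).2 x.2 ≤ κ * ε / 2 := by
      rw [dist_eq_norm, ← Prod.snd_sub]
      exact (norm_snd_le _).trans ((hΨd x (hcylA hx)).trans hmle)
    have h2 := Metric.mem_cthickening_of_dist_le _ _ _ A hx.2 h1
    have h3 := Metric.cthickening_cthickening_subset (ε := κ * ε / 2) (δ := κ * ε / 2)
      (by positivity) (by positivity) (segment a b) h2
    rwa [add_halves] at h3
  · intro z _
    field_simp
    ring
  · exact fun x hx => (hΨd x (hcylA hx)).trans hmle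
  · refine inCkBall_of_bound norm_coverBasis_le huniq
      (isOpen_cyl (A := V) Metric.isOpen_thickening) hcylAV hQC
      hQb fun x hx => ?_
    have h1 := hQ x (hcylAV hx)
    simp only [Function.comp]
    rw [div_eq_iff hε2, hlift x (hcylA hx), average_proj]
    change h (Ψ x).2 + ε * f (proj (Ψ x)) - (h x.2 + _) = _
    have h2 : h (Ψ x).2 + ε * f (proj (Ψ x)) =
      h x.2 + ε * angleInt 0 1 (f ∘ proj) x + ε ^ 2 * Q x := h1
    rw [h2]; ring

theorem exists_pos_le_of_lt (r : ℕ) {u : ℕ → ℝ} (hu : ∀ l, 0 < u l) :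
    ∃ e : ℝ, 0 < e ∧ ∀ l < r, e ≤ u l := by
  induction r with
  | zero => exact ⟨1, one_pos, by simp⟩
  | succ r ih =>
    obtain ⟨e, he, h⟩ := ih
    refine ⟨min e (u r), lt_min he (hu r), fun l hl => ?_⟩
    rcases Nat.lt_succ_iff_lt_or_eq.1 hl with hl | rfl
    · exact (min_le_left _ _).trans (h l hl)
    · exact min_le_right _ _

theorem exists_pos_ge_of_lt (r : ℕ) (u : ℕ → ℝ) : ∃ e : ℝ, 0 < e ∧ ∀ l < r, u l ≤ e := by
  induction r with
  | zero => exact ⟨1, one_pos, by simp⟩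
  | succ r ih =>
    obtain ⟨e, he, h⟩ := ih
    refine ⟨max e (u r), lt_max_of_lt_left he, fun l hl => ?_⟩
    rcases Nat.lt_succ_iff_lt_or_eq.1 hl with hl | rfl
    · exact (h l hl).trans (le_max_left _ _)
    · exact le_max_right _ _

end Assembly

end NearIntegrable

theorem mainTheorem3 (r : ℕ) (R len ϖ : ℝ) (hR : 0 < R) (hlen : 0 ≤ len) (hϖ : 0 < ϖ) :
    ∃ κ ε₀ C : ℝ, 0 < κ ∧ 0 < ε₀ ∧ 0 < C ∧
      ∀ l : ℕ, 1 ≤ l → 2 * (l + 1) + 3 ≤ r →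
      ∀ (h : NearIntegrable.Action → ℝ) (f : NearIntegrable.Phase → ℝ) (c d a b : ℝ),
        NearIntegrable.ActionCkBall (l + 3) (NearIntegrable.ball R) 1 h →
        NearIntegrable.PhaseCkBall r (NearIntegrable.ball R) 1 f →
        Set.Icc c d ⊆ Set.Icc (-R) R →
        (∀ I₁ ∈ Set.Icc c d, NearIntegrable.freq R h 0 ![I₁, 0] = 0) →
        a ≤ b → b - a = len → Set.Icc a b ⊆ Set.Icc c d →
        (∀ I₁ ∈ Set.Icc a b, ϖ ≤ NearIntegrable.freq R h 1 ![I₁, 0]) →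
      ∀ ε : ℝ, 0 < ε → ε ≤ ε₀ →
        NearIntegrable.segmentNhd a b (κ * ε) ⊆ NearIntegrable.ball R →
        ∃ (Φ : NearIntegrable.Phase → NearIntegrable.Phase)
          (Ψ : NearIntegrable.Cover → NearIntegrable.Cover) (f' : NearIntegrable.Phase → ℝ),
          NearIntegrable.IsSymplecticEmbedding (l + 1)
            (NearIntegrable.segmentNhd a b (κ * ε / 2)) Φ Ψ ∧
          Set.MapsTo Φ (NearIntegrable.domain a b (κ * ε / 2))
            (NearIntegrable.domain a b (κ * ε)) ∧
          (∀ z ∈ NearIntegrable.domain a b (κ * ε / 2),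
            NearIntegrable.hamiltonian h ε f (Φ z) =
              h z.2 + ε * NearIntegrable.average f (z.1 0) z.2 + ε ^ 2 * f' z) ∧
          (∀ x ∈ (Set.univ : Set (Fin 2 → ℝ)) ×ˢ NearIntegrable.segmentNhd a b (κ * ε / 2),
            ‖Ψ x - x‖ ≤ κ * ε / 2) ∧
          NearIntegrable.PhaseCkBall l (NearIntegrable.segmentNhd a b (κ * ε / 2)) C f' := by
  choose κ₀ hκ₀ hnf using fun l : ℕ => NearIntegrable.normal_form_fixed_order l ϖ hϖ
  -- Only the finitely many l < r occur, so extremal constants over them depend on r alone. The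
  -- common κ comes first, since ε₀ and C depend on it.
  obtain ⟨κ, hκ, hκle⟩ := NearIntegrable.exists_pos_ge_of_lt r κ₀
  have hnf' : ∀ l : ℕ, ∃ ε₀ C : ℝ, 0 < ε₀ ∧ 0 < C ∧ (κ₀ l ≤ κ → _) := fun l => by
    by_cases hl : κ₀ l ≤ κ
    · obtain ⟨ε₀, C, h1, h2, h3⟩ := hnf l κ hl
      exact ⟨ε₀, C, h1, h2, fun _ => h3⟩
    · exact ⟨1, 1, one_pos, one_pos, fun h => absurd h hl⟩
  choose e C he _ hmain using hnf'
  obtain ⟨ε₀, hε₀, hεle⟩ := NearIntegrable.exists_pos_le_of_lt r he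
  obtain ⟨C₀, hC₀, hCle⟩ := NearIntegrable.exists_pos_ge_of_lt r C
  refine ⟨κ, ε₀, C₀, hκ, hε₀, hC₀, ?_⟩
  intro l _ hlr h f c d a b hh hf _ hω0 hab _ habcd hω1 ε hε hεε₀ hsub
  have hl : l < r := by omega
  obtain ⟨Φ, Ψ, f', h1, h2, h3, h4, h5⟩ := hmain l (hκle l hl) R h f a b hh
    (hf.mono_order (by omega)) hab (fun I hI => hω0 I (habcd hI)) hω1 ε hε
    (hεε₀.trans (hεle l hl)) hsub
  exact ⟨Φ, Ψ, f', h1, h2, h3, h4, h5.mono_bound (hCle l hl)⟩
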